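/- **Conventions.** Algebras are associative and unital over a commutative ring $k$. A *left bialgebroid* over an algebra $L$ is an algebra $H$ with algebra maps $s_L:L\to H$, $t_L:L^{op}\to H$ with commuting images, and an $L$-coring structure $\Delta_L:H\to H\otimes_LH$, $\varepsilon_L:H\to L$ for the bimodule structure $l\cdot h\cdot l'=s_L(l)t_L(l')h$, such that $\Delta_L$ is a unital multiplicative map into the Takeuchi product $\{\sum h_i\otimes h_i' : \sum h_it_L(l)\otimes h_i'=\sum h_i\otimes h_i's_L(l)\ \forall l\}$ and $h\cdot l=\varepsilon_L(hs_L(l))$ is a left $H$-action on $L$ (extending the regular one). A *right bialgebroid* over $R$, $(s_R,t_R,\Delta_R,\varepsilon_R)$, is defined symmetrically, with $r\cdot h\cdot r'=hs_R(r')t_R(r)$. A *Hopf algebroid* $\mathcal H=(\mathcal H_L,\mathcal H_R,S)$ over $R$ consists of a left $L$-bialgebroid and a right $R$-bialgebroid on the same algebra $H$ (for some algebra $L$) and a $k$-linear map $S:H\to H$ such that: $s_L\varepsilon_Lt_R=t_R$, $t_R\varepsilon_Rs_L=s_L$, $t_L\varepsilon_Ls_R=s_R$, $s_R\varepsilon_Rt_L=t_L$;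 $(\Delta_L\otimes_R\mathrm{id})\Delta_R=(\mathrm{id}\otimes_L\Delta_R)\Delta_L$ and $(\Delta_R\otimes_L\mathrm{id})\Delta_L=(\mathrm{id}\otimes_R\Delta_L)\Delta_R$; $S(t_L(l)ht_R(r))=s_R(r)S(h)s_L(l)$; and, in Sweedler notation, $S(h_{[1]})h_{[2]}=s_R\varepsilon_R(h)$ for $\Delta_L(h)=h_{[1]}\otimes h_{[2]}$ and $h^{[1]}S(h^{[2]})=s_L\varepsilon_L(h)$ for $\Delta_R(h)=h^{[1]}\otimes h^{[2]}$. A *right $\mathcal H$-comodule algebra* is an $R$-ring $\eta:R\to M$ with a right $L$-module structure, a right $\mathcal H_R$-coaction $\rho_R:M\to M\otimes_RH$ and a right $\mathcal H_L$-coaction $\rho_L:M\to M\otimes_LH$, each of which is colinear for the other, both unital and multiplicative. A *local covering* of an algebra $A$ is a pair $(B,\mathcal H)$ where $A\subseteq B$ is an algebra extension, $\mathcal H$ is a Hopf algebroid over $R=A$ with bijective antipode which is finitely generated projective over its base algebras, $B$ is a right $\mathcal H$-comodule algebra whose $A$-ring structure is the inclusion $A\subseteq B$, $B$ is a finitely generated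 projective $A$-module, the coinvariants $\{b:\rho_R(b)=b\otimes_A1\}$ and $\{b:\rho_L(b)=b\otimes_L1\}$ are both equal to $A$, and the Galois maps $$B\otimes_AB\to B\otimes_AH,\ a\otimes b\mapsto a\,\rho_R(b),\qquad B\otimes_AB\to B\otimes_LH,\ a\otimes b\mapsto \rho_L(a)(b\otimes 1)$$ are bijective. For $A=k=\mathbb C$ (with $L=R=\mathbb C$) this is a *covering of a point*. **Theorem.** Let $X$ be a compact Hausdorff space, $k=\mathbb C$, and let $(B,\mathcal H)$ be a local covering of $A=C(X)$, given by a comodule algebra structure $(\rho_R,\rho_L)$ on $B$, in which $A$ is central: $A\subseteq Z(B)$ and $s_R(A),t_R(A)\subseteq Z(H)$. (The axioms give $s_L(L)=t_R(A)$ and $t_L(L)=s_R(A)$.) Let $x\in X$, $I_x=\{f\in C(X): f(x)=0\}$, and let $\chi_x(l)=\varepsilon_R(s_L(l))(x)$ for $l\in L$. Let $E_x=B/I_xB$ be the fibre algebra of $B$ at $x$ and $H_x=H/s_R(I_x)H$ the fibre of $H$ at $x$. Then: 1. $\chi_x$ is a character of $L$, and the two-sided ideals of $H$ generated by $s_R(I_x)$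 and by $s_L(\ker\chi_x)$ coincide, so that the fibres of $\mathcal H_L$ and of $\mathcal H_R$ at $x$ have the same underlying algebra $H_x$. 2. All structure maps of $\mathcal H$ descend to $H_x$ along $H\to H_x$, evaluation at $x$ and $\chi_x$, and make it a Hopf algebroid $\mathcal H_x$ over $\mathbb C$. The coactions $\rho_R,\rho_L$ and the $L$-module structure descend to $E_x$ and make it a right $\mathcal H_x$-comodule algebra. 3. With these structures $(E_x,\mathcal H_x)$ is a covering of the point: $E_x$ and $H_x$ are finite-dimensional, $\mathbb C$ embeds in $E_x$, the antipode of $\mathcal H_x$ is bijective, the coinvariants of both coactions on $E_x$ are $\mathbb C$, and both Galois maps $E_x\otimes E_x\to E_x\otimes H_x$ are bijective. -/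

import Mathlib

noncomputable section

open scoped TensorProduct
open MulOpposite

namespace NCCovering

universe u₁ u₂ u₃ u₄ u₅ u₆ u₇

/-! ### Module structures and balanced tensor products

All algebras are unital associative algebras over a commutative ring `k`. Since one and the same
`k`-module carries several module structures over the (possibly noncommutative) base algebras, a left
`S`-module structure on a `k`-module `M` is recorded as a `k`-algebra map `S → End_k M`, and a right
`S`-module structure as a `k`-algebra map `Sᵐᵒᵖ → End_k M`. -/

section Balanced

variable {k : Type u₁} [CommRing k]

/-- The action of `S` on the algebra `H` by left multiplication through `f : S → H`. -/
def leftMul {S : Type u₂} {H : Type u₃} [Ring S] [Algebra k S] [Ring H] [Algebra k H]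
    (f : S →ₐ[k] H) : S →ₐ[k] Module.End k H :=
  (Algebra.lmul k H).comp f

/-- The action of `S` on the algebra `H` by right multiplication through `f : S → Hᵐᵒᵖ`. -/
def rightMul {S : Type u₂} {H : Type u₃} [Ring S] [Algebra k S] [Ring H] [Algebra k H]
    (f : S →ₐ[k] Hᵐᵒᵖ) : S →ₐ[k] Module.End k H :=
  (Algebra.lsmul k k H).comp f

/-- `M` is a finitely generated projective `S`-module with respect to the given action. -/
def IsFGProjective {S : Type u₂} {M : Type u₃} [Ring S] [Algebra k S] [AddCommGroup M] [Module k M]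
    (φ : S →ₐ[k] Module.End k M) : Prop :=
  letI : Module S M := Module.compHom M φ.toRingHom
  Module.Finite S M ∧ Module.Projective S M

variable {R : Type u₂} {S : Type u₃} {M : Type u₄} {N : Type u₅} {P : Type u₆}
  [Ring R] [Algebra k R] [Ring S] [Algebra k S]
  [AddCommGroup M] [Module k M] [AddCommGroup N] [Module k N] [AddCommGroup P] [Module k P]

/-- The relations `m · r ⊗ n - m ⊗ r · n` in `M ⊗[k] N`. -/
def balRel (ψ : Rᵐᵒᵖ →ₐ[k] Module.End k M) (φ : R →ₐ[k] Module.End k N) :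
    Submodule k (M ⊗[k] N) :=
  Submodule.span k {z | ∃ (r : R) (m : M) (n : N), z = ψ (op r) m ⊗ₜ[k] n - m ⊗ₜ[k] φ r n}

/-- The tensor product `M ⊗_R N` of a right and a left `R`-module. -/
abbrev Bal (ψ : Rᵐᵒᵖ →ₐ[k] Module.End k M) (φ : R →ₐ[k] Module.End k N) :=
  (M ⊗[k] N) ⧸ balRel ψ φ

/-- The projection `M ⊗[k] N → M ⊗_R N`. -/
abbrev Bal.mk (ψ : Rᵐᵒᵖ →ₐ[k] Module.End k M) (φ : R →ₐ[k] Module.End k N) :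
    M ⊗[k] N →ₗ[k] Bal ψ φ :=
  (balRel ψ φ).mkQ

/-- The relations defining the threefold tensor product `M ⊗_R N ⊗_S P`. -/
def balRel₃ (ψ : Rᵐᵒᵖ →ₐ[k] Module.End k M) (φ : R →ₐ[k] Module.End k N)
    (ψ' : Sᵐᵒᵖ →ₐ[k] Module.End k N) (φ' : S →ₐ[k] Module.End k P) :
    Submodule k (M ⊗[k] (N ⊗[k] P)) :=
  Submodule.span k
    ({z | ∃ (r : R) (m : M) (n : N) (p : P),
        z = ψ (op r) m ⊗ₜ[k] (n ⊗ₜ[k] p) - m ⊗ₜ[k] (φ r n ⊗ₜ[k] p)} ∪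
     {z | ∃ (s : S) (m : M) (n : N) (p : P),
        z = m ⊗ₜ[k] (ψ' (op s) n ⊗ₜ[k] p) - m ⊗ₜ[k] (n ⊗ₜ[k] φ' s p)})

/-- The threefold tensor product `M ⊗_R N ⊗_S P`. -/
abbrev Bal₃ (ψ : Rᵐᵒᵖ →ₐ[k] Module.End k M) (φ : R →ₐ[k] Module.End k N)
    (ψ' : Sᵐᵒᵖ →ₐ[k] Module.End k N) (φ' : S →ₐ[k] Module.End k P) :=
  (M ⊗[k] (N ⊗[k] P)) ⧸ balRel₃ ψ φ ψ' φ'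

/-- The canonical map `(M ⊗_R N) ⊗[k] P → M ⊗_R N ⊗_S P`. -/
def assocL (ψ : Rᵐᵒᵖ →ₐ[k] Module.End k M) (φ : R →ₐ[k] Module.End k N)
    (ψ' : Sᵐᵒᵖ →ₐ[k] Module.End k N) (φ' : S →ₐ[k] Module.End k P) :
    Bal ψ φ ⊗[k] P →ₗ[k] Bal₃ ψ φ ψ' φ' :=
  TensorProduct.lift <| (balRel ψ φ).liftQ
    (TensorProduct.curry ((balRel₃ ψ φ ψ' φ').mkQ ∘ₗ (TensorProduct.assoc k M N P).toLinearMap))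
    (by
      rw [balRel, Submodule.span_le]
      rintro _ ⟨r, m, n, rfl⟩
      rw [SetLike.mem_coe, LinearMap.mem_ker]
      ext p
      have h : ψ (op r) m ⊗ₜ[k] (n ⊗ₜ[k] p) - m ⊗ₜ[k] (φ r n ⊗ₜ[k] p) ∈ balRel₃ ψ φ ψ' φ' :=
        Submodule.subset_span (Or.inl ⟨r, m, n, p, rfl⟩)
      simpa [sub_eq_zero, Submodule.Quotient.eq] using h)

/-- The canonical map `M ⊗[k] (N ⊗_S P) → M ⊗_R N ⊗_S P`. -/
def assocR (ψ : Rᵐᵒᵖ →ₐ[k] Module.End k M) (φ : R →ₐ[k] Module.End k N)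
    (ψ' : Sᵐᵒᵖ →ₐ[k] Module.End k N) (φ' : S →ₐ[k] Module.End k P) :
    M ⊗[k] Bal ψ' φ' →ₗ[k] Bal₃ ψ φ ψ' φ' :=
  TensorProduct.lift <| LinearMap.flip <| (balRel ψ' φ').liftQ
    ((TensorProduct.mk k M (N ⊗[k] P)).compr₂ (balRel₃ ψ φ ψ' φ').mkQ).flip
    (by
      rw [balRel, Submodule.span_le]
      rintro _ ⟨s, n, p, rfl⟩
      rw [SetLike.mem_coe, LinearMap.mem_ker]
      ext m
      have h : m ⊗ₜ[k] (ψ' (op s) n ⊗ₜ[k] p) - m ⊗ₜ[k] (n ⊗ₜ[k] φ' s p) ∈ balRel₃ ψ φ ψ' φ' :=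
        Submodule.subset_span (Or.inr ⟨s, m, n, p, rfl⟩)
      simpa [sub_eq_zero, Submodule.Quotient.eq] using h)

end Balanced

/-! ### Bialgebroids and Hopf algebroids

A coproduct takes values in a balanced tensor product. Formulas in Sweedler notation are written with
a representative `u ∈ H ⊗[k] H` of `Δ h`, and are required for every representative; products of
representatives are taken factorwise in the algebra `H ⊗[k] H`. -/

/-- A left bialgebroid over `L` with underlying algebra `H`. The `L`-bimodule structure is
`l · h · l' = s(l) t(l') h`. -/
structure LeftBialgebroid (k : Type u₁) (L : Type u₂) (H : Type u₃) [CommRing k] [Ring L]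
    [Algebra k L] [Ring H] [Algebra k H] where
  /-- the source map `s` -/
  source : L →ₐ[k] H
  /-- the target map `t` -/
  target : Lᵐᵒᵖ →ₐ[k] H
  source_target_comm : ∀ l l', source l * target (op l') = target (op l') * source l
  /-- the coproduct `Δ : H → H ⊗_L H` -/
  comul : H →ₗ[k] Bal (leftMul target) (leftMul source)
  /-- the counit `ε : H → L` -/
  counit : H →ₗ[k] L
  comul_bimodule : ∀ l l' h u, Bal.mk _ _ u = comul h →
    comul (source l * target (op l') * h) = Bal.mk _ _ ((source l ⊗ₜ target (op l')) * u)
  counit_bimodule : ∀ l l' h, counit (source l * target (op l') * h) = l * counit h * l'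
  coassoc : ∀ h u, Bal.mk _ _ u = comul h →
    assocL (leftMul target) (leftMul source) (leftMul target) (leftMul source)
        (comul.rTensor H u) =
      assocR (leftMul target) (leftMul source) (leftMul target) (leftMul source)
        (comul.lTensor H u)
  /-- `s(ε(h₁)) h₂ = h` -/
  counit_left : ∀ h u, Bal.mk _ _ u = comul h →
    LinearMap.mul' k H (TensorProduct.map (source.toLinearMap ∘ₗ counit) LinearMap.id u) = h
  /-- `t(ε(h₂)) h₁ = h` -/
  counit_right : ∀ h u, Bal.mk _ _ u = comul h →
    LinearMap.mul' k H (TensorProduct.map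
      (target.toLinearMap ∘ₗ (opLinearEquiv k).toLinearMap ∘ₗ counit) LinearMap.id
      (TensorProduct.comm k H H u)) = h
  /-- `Δ` takes values in the Takeuchi product: `h₁ t(l) ⊗ h₂ = h₁ ⊗ h₂ s(l)` -/
  takeuchi : ∀ l h u, Bal.mk _ _ u = comul h →
    Bal.mk (leftMul target) (leftMul source) (u * (target (op l) ⊗ₜ 1)) =
      Bal.mk _ _ (u * (1 ⊗ₜ source l))
  comul_one : comul 1 = Bal.mk _ _ (1 ⊗ₜ 1)
  comul_mul : ∀ g h u v, Bal.mk _ _ u = comul g → Bal.mk _ _ v = comul h →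
    comul (g * h) = Bal.mk _ _ (u * v)
  counit_one : counit 1 = 1
  /-- `h · l = ε(h s(l))` is a left action of `H` on `L` -/
  counit_mul : ∀ g h, counit (g * h) = counit (g * source (counit h))

/-- A right bialgebroid over `R` with underlying algebra `H`. The `R`-bimodule structure is
`r · h · r' = h s(r') t(r)`. -/
structure RightBialgebroid (k : Type u₁) (R : Type u₂) (H : Type u₃) [CommRing k] [Ring R]
    [Algebra k R] [Ring H] [Algebra k H] where
  /-- the source map `s` -/
  source : R →ₐ[k] H
  /-- the target map `t` -/
  target : Rᵐᵒᵖ →ₐ[k] H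
  source_target_comm : ∀ r r', source r * target (op r') = target (op r') * source r
  /-- the coproduct `Δ : H → H ⊗_R H` -/
  comul : H →ₗ[k] Bal (rightMul (AlgHom.op source)) (rightMul (AlgHom.opComm.symm target))
  /-- the counit `ε : H → R` -/
  counit : H →ₗ[k] R
  comul_bimodule : ∀ r r' h u, Bal.mk _ _ u = comul h →
    comul (h * source r' * target (op r)) = Bal.mk _ _ (u * (target (op r) ⊗ₜ source r'))
  counit_bimodule : ∀ r r' h, counit (h * source r' * target (op r)) = r * counit h * r'
  coassoc : ∀ h u, Bal.mk _ _ u = comul h →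
    assocL (rightMul (AlgHom.op source)) (rightMul (AlgHom.opComm.symm target))
        (rightMul (AlgHom.op source)) (rightMul (AlgHom.opComm.symm target))
        (comul.rTensor H u) =
      assocR (rightMul (AlgHom.op source)) (rightMul (AlgHom.opComm.symm target))
        (rightMul (AlgHom.op source)) (rightMul (AlgHom.opComm.symm target))
        (comul.lTensor H u)
  /-- `h₂ t(ε(h₁)) = h` -/
  counit_left : ∀ h u, Bal.mk _ _ u = comul h →
    LinearMap.mul' k H (TensorProduct.map LinearMap.id
      (target.toLinearMap ∘ₗ (opLinearEquiv k).toLinearMap ∘ₗ counit)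
      (TensorProduct.comm k H H u)) = h
  /-- `h₁ s(ε(h₂)) = h` -/
  counit_right : ∀ h u, Bal.mk _ _ u = comul h →
    LinearMap.mul' k H (TensorProduct.map LinearMap.id (source.toLinearMap ∘ₗ counit) u) = h
  /-- `Δ` takes values in the Takeuchi product: `s(r) h₁ ⊗ h₂ = h₁ ⊗ t(r) h₂` -/
  takeuchi : ∀ r h u, Bal.mk _ _ u = comul h →
    Bal.mk (rightMul (AlgHom.op source)) (rightMul (AlgHom.opComm.symm target))
        ((source r ⊗ₜ 1) * u) =
      Bal.mk _ _ ((1 ⊗ₜ target (op r)) * u)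
  comul_one : comul 1 = Bal.mk _ _ (1 ⊗ₜ 1)
  comul_mul : ∀ g h u v, Bal.mk _ _ u = comul g → Bal.mk _ _ v = comul h →
    comul (g * h) = Bal.mk _ _ (u * v)
  counit_one : counit 1 = 1
  /-- `r · h = ε(s(r) h)` is a right action of `H` on `R` -/
  counit_mul : ∀ g h, counit (g * h) = counit (source (counit g) * h)

section Actions

variable {k : Type u₁} {L : Type u₂} {H : Type u₃} [CommRing k] [Ring L] [Algebra k L]
  [Ring H] [Algebra k H]

/-- `l · h = s(l) h` -/
abbrev LeftBialgebroid.actL (𝓑 : LeftBialgebroid k L H) : L →ₐ[k] Module.End k H :=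
  leftMul 𝓑.source

/-- `h · l = t(l) h` -/
abbrev LeftBialgebroid.actR (𝓑 : LeftBialgebroid k L H) : Lᵐᵒᵖ →ₐ[k] Module.End k H :=
  leftMul 𝓑.target

/-- `r · h = h t(r)` -/
abbrev RightBialgebroid.actL (𝓑 : RightBialgebroid k L H) : L →ₐ[k] Module.End k H :=
  rightMul (AlgHom.opComm.symm 𝓑.target)

/-- `h · r = h s(r)` -/
abbrev RightBialgebroid.actR (𝓑 : RightBialgebroid k L H) : Lᵐᵒᵖ →ₐ[k] Module.End k H :=
  rightMul (AlgHom.op 𝓑.source)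

end Actions

/-- A Hopf algebroid with underlying algebra `H`, consisting of a left bialgebroid over `L`, a right
bialgebroid over `R` and an antipode. -/
structure HopfAlgebroid (k : Type u₁) (L : Type u₂) (R : Type u₃) (H : Type u₄) [CommRing k]
    [Ring L] [Algebra k L] [Ring R] [Algebra k R] [Ring H] [Algebra k H] where
  /-- the left bialgebroid -/
  left : LeftBialgebroid k L H
  /-- the right bialgebroid -/
  right : RightBialgebroid k R H
  /-- the antipode `S` -/
  antipode : H →ₗ[k] H
  sL_εL_tR : ∀ r, left.source (left.counit (right.target (op r))) = right.target (op r)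
  tR_εR_sL : ∀ l, right.target (op (right.counit (left.source l))) = left.source l
  tL_εL_sR : ∀ r, left.target (op (left.counit (right.source r))) = right.source r
  sR_εR_tL : ∀ l, right.source (right.counit (left.target (op l))) = left.target (op l)
  /-- `(Δ_L ⊗_R id) Δ_R = (id ⊗_L Δ_R) Δ_L` in `H ⊗_L H ⊗_R H` -/
  coassoc_LR : ∀ h u v, Bal.mk _ _ u = right.comul h → Bal.mk _ _ v = left.comul h →
    assocL left.actR left.actL right.actR right.actL (left.comul.rTensor H u) =
      assocR left.actR left.actL right.actR right.actL (right.comul.lTensor H v)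
  /-- `(Δ_R ⊗_L id) Δ_L = (id ⊗_R Δ_L) Δ_R` in `H ⊗_R H ⊗_L H` -/
  coassoc_RL : ∀ h u v, Bal.mk _ _ u = left.comul h → Bal.mk _ _ v = right.comul h →
    assocL right.actR right.actL left.actR left.actL (right.comul.rTensor H u) =
      assocR right.actR right.actL left.actR left.actL (left.comul.lTensor H v)
  antipode_mul : ∀ l r h, antipode (left.target (op l) * h * right.target (op r)) =
    right.source r * antipode h * left.source l
  /-- `S(h₁) h₂ = s_R(ε_R(h))` for the legs of `Δ_L` -/
  antipode_left : ∀ h u, Bal.mk _ _ u = left.comul h →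
    LinearMap.mul' k H (antipode.rTensor H u) = right.source (right.counit h)
  /-- `h₁ S(h₂) = s_L(ε_L(h))` for the legs of `Δ_R` -/
  antipode_right : ∀ h u, Bal.mk _ _ u = right.comul h →
    LinearMap.mul' k H (antipode.lTensor H u) = left.source (left.counit h)

/-- The geometric morphisms of Hopf algebroids given by maps `fL`, `fR` of the base algebras and a map
`φ` of the underlying algebras. -/
structure HopfAlgebroid.IsGeometricHom {k : Type u₁} {L R H : Type*} {L' R' H' : Type*} [CommRing k]
    [Ring L] [Algebra k L] [Ring R] [Algebra k R] [Ring H] [Algebra k H]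
    [Ring L'] [Algebra k L'] [Ring R'] [Algebra k R'] [Ring H'] [Algebra k H']
    (𝓗 : HopfAlgebroid k L R H) (𝓗' : HopfAlgebroid k L' R' H')
    (fL : L →ₐ[k] L') (fR : R →ₐ[k] R') (φ : H →ₐ[k] H') : Prop where
  source_left : ∀ l, φ (𝓗.left.source l) = 𝓗'.left.source (fL l)
  target_left : ∀ l, φ (𝓗.left.target (op l)) = 𝓗'.left.target (op (fL l))
  counit_left : ∀ h, 𝓗'.left.counit (φ h) = fL (𝓗.left.counit h)
  source_right : ∀ r, φ (𝓗.right.source r) = 𝓗'.right.source (fR r)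
  target_right : ∀ r, φ (𝓗.right.target (op r)) = 𝓗'.right.target (op (fR r))
  counit_right : ∀ h, 𝓗'.right.counit (φ h) = fR (𝓗.right.counit h)
  comul_left : ∀ h u, Bal.mk _ _ u = 𝓗.left.comul h →
    𝓗'.left.comul (φ h) = Bal.mk _ _ (TensorProduct.map φ.toLinearMap φ.toLinearMap u)
  comul_right : ∀ h u, Bal.mk _ _ u = 𝓗.right.comul h →
    𝓗'.right.comul (φ h) = Bal.mk _ _ (TensorProduct.map φ.toLinearMap φ.toLinearMap u)
  antipode : ∀ h, φ (𝓗.antipode h) = 𝓗'.antipode (φ h)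

/-! ### Comodule algebras, Galois extensions, coverings -/

/-- A right `𝓗`-comodule algebra structure on the `R`-ring `η : R → M`. The right `R`-module structure
of `M` is `m · r = m η(r)`. Sweedler formulas are written with representatives, as above. -/
structure ComoduleAlgebra {k : Type u₁} {L : Type u₂} {R : Type u₃} {H : Type u₄} {M : Type u₅}
    [CommRing k] [Ring L] [Algebra k L] [Ring R] [Algebra k R] [Ring H] [Algebra k H]
    [Ring M] [Algebra k M] (𝓗 : HopfAlgebroid k L R H) (η : R →ₐ[k] M) where
  /-- the right `L`-module structure of `M` -/
  actL : Lᵐᵒᵖ →ₐ[k] Module.End k M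
  /-- the coaction `ρ_R : M → M ⊗_R H` -/
  coactR : M →ₗ[k] Bal (rightMul (AlgHom.op η)) 𝓗.right.actL
  /-- the coaction `ρ_L : M → M ⊗_L H` -/
  coactL : M →ₗ[k] Bal actL 𝓗.left.actL
  coactR_R : ∀ m r u, Bal.mk _ _ u = coactR m →
    coactR (m * η r) = Bal.mk _ _ (u * (1 ⊗ₜ 𝓗.right.source r))
  coactR_L : ∀ m l u, Bal.mk _ _ u = coactR m →
    coactR (actL (op l) m) = Bal.mk _ _ ((1 ⊗ₜ 𝓗.left.target (op l)) * u)
  coactL_R : ∀ m r u, Bal.mk _ _ u = coactL m →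
    coactL (m * η r) = Bal.mk _ _ (u * (1 ⊗ₜ 𝓗.right.source r))
  coactL_L : ∀ m l u, Bal.mk _ _ u = coactL m →
    coactL (actL (op l) m) = Bal.mk _ _ ((1 ⊗ₜ 𝓗.left.target (op l)) * u)
  /-- `(ρ_R ⊗ id) ρ_R = (id ⊗ Δ_R) ρ_R` -/
  coassoc_RR : ∀ m u, Bal.mk _ _ u = coactR m →
    assocL (rightMul (AlgHom.op η)) 𝓗.right.actL 𝓗.right.actR 𝓗.right.actL (coactR.rTensor H u) =
      assocR (rightMul (AlgHom.op η)) 𝓗.right.actL 𝓗.right.actR 𝓗.right.actL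
        (𝓗.right.comul.lTensor M u)
  /-- `(ρ_L ⊗ id) ρ_L = (id ⊗ Δ_L) ρ_L` -/
  coassoc_LL : ∀ m u, Bal.mk _ _ u = coactL m →
    assocL actL 𝓗.left.actL 𝓗.left.actR 𝓗.left.actL (coactL.rTensor H u) =
      assocR actL 𝓗.left.actL 𝓗.left.actR 𝓗.left.actL (𝓗.left.comul.lTensor M u)
  /-- `(ρ_R ⊗_L id) ρ_L = (id ⊗_R Δ_L) ρ_R` -/
  coassoc_RL : ∀ m u v, Bal.mk _ _ u = coactL m → Bal.mk _ _ v = coactR m →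
    assocL (rightMul (AlgHom.op η)) 𝓗.right.actL 𝓗.left.actR 𝓗.left.actL (coactR.rTensor H u) =
      assocR (rightMul (AlgHom.op η)) 𝓗.right.actL 𝓗.left.actR 𝓗.left.actL
        (𝓗.left.comul.lTensor M v)
  /-- `(ρ_L ⊗_R id) ρ_R = (id ⊗_L Δ_R) ρ_L` -/
  coassoc_LR : ∀ m u v, Bal.mk _ _ u = coactR m → Bal.mk _ _ v = coactL m →
    assocL actL 𝓗.left.actL 𝓗.right.actR 𝓗.right.actL (coactL.rTensor H u) =
      assocR actL 𝓗.left.actL 𝓗.right.actR 𝓗.right.actL (𝓗.right.comul.lTensor M v)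
  /-- `m₀ · ε_R(m₁) = m` for the legs of `ρ_R` -/
  counit_R : ∀ m u, Bal.mk _ _ u = coactR m →
    LinearMap.mul' k M (TensorProduct.map LinearMap.id (η.toLinearMap ∘ₗ 𝓗.right.counit) u) = m
  /-- `m₀ · ε_L(m₁) = m` for the legs of `ρ_L` -/
  counit_L : ∀ m u, Bal.mk _ _ u = coactL m →
    TensorProduct.lift
      (actL.toLinearMap ∘ₗ (opLinearEquiv k).toLinearMap ∘ₗ 𝓗.left.counit).flip u = m
  /-- `η(r) m₀ ⊗ m₁ = m₀ ⊗ t_R(r) m₁`, so that factorwise products make sense -/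
  takeuchi_R : ∀ m r u, Bal.mk _ _ u = coactR m →
    Bal.mk (rightMul (AlgHom.op η)) 𝓗.right.actL ((η r ⊗ₜ 1) * u) =
      Bal.mk _ _ ((1 ⊗ₜ 𝓗.right.target (op r)) * u)
  /-- `m₀ (1 · l) ⊗ m₁ = m₀ ⊗ m₁ s_L(l)`, so that factorwise products make sense -/
  takeuchi_L : ∀ m l u, Bal.mk _ _ u = coactL m →
    Bal.mk actL 𝓗.left.actL (u * (actL (op l) 1 ⊗ₜ 1)) =
      Bal.mk _ _ (u * (1 ⊗ₜ 𝓗.left.source l))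
  coactR_mul : ∀ m n u v, Bal.mk _ _ u = coactR m → Bal.mk _ _ v = coactR n →
    coactR (m * n) = Bal.mk _ _ (u * v)
  coactL_mul : ∀ m n u v, Bal.mk _ _ u = coactL m → Bal.mk _ _ v = coactL n →
    coactL (m * n) = Bal.mk _ _ (u * v)
  coactR_one : coactR 1 = Bal.mk _ _ (1 ⊗ₜ 1)
  coactL_one : coactL 1 = Bal.mk _ _ (1 ⊗ₜ 1)

/-- The map `p` of comodule algebras is compatible with the module structures and with the coactions
along maps `fL` of the base algebras and `φ` of the Hopf algebroids. -/
structure ComoduleAlgebra.IsCompatible {k : Type u₁} {L R H M : Type*} {L' R' H' M' : Type*}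
    [CommRing k] [Ring L] [Algebra k L] [Ring R] [Algebra k R] [Ring H] [Algebra k H]
    [Ring M] [Algebra k M] [Ring L'] [Algebra k L'] [Ring R'] [Algebra k R'] [Ring H'] [Algebra k H']
    [Ring M'] [Algebra k M'] {𝓗 : HopfAlgebroid k L R H} {η : R →ₐ[k] M}
    {𝓗' : HopfAlgebroid k L' R' H'} {η' : R' →ₐ[k] M'}
    (ρ : ComoduleAlgebra 𝓗 η) (ρ' : ComoduleAlgebra 𝓗' η')
    (fL : L →ₐ[k] L') (fR : R →ₐ[k] R') (φ : H →ₐ[k] H') (p : M →ₐ[k] M') : Prop where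
  unit : ∀ r, p (η r) = η' (fR r)
  actL : ∀ l m, p (ρ.actL (op l) m) = ρ'.actL (op (fL l)) (p m)
  coactR : ∀ m u, Bal.mk _ _ u = ρ.coactR m →
    ρ'.coactR (p m) = Bal.mk _ _ (TensorProduct.map p.toLinearMap φ.toLinearMap u)
  coactL : ∀ m u, Bal.mk _ _ u = ρ.coactL m →
    ρ'.coactL (p m) = Bal.mk _ _ (TensorProduct.map p.toLinearMap φ.toLinearMap u)

section Covering

variable {k : Type u₁} {L : Type u₂} {A : Type u₃} {H : Type u₄} {B : Type u₅}
  [CommRing k] [Ring L] [Algebra k L] [Ring A] [Algebra k A] [Ring H] [Algebra k H]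
  [Ring B] [Algebra k B] {𝓗 : HopfAlgebroid k L A H} {ι : A →ₐ[k] B}

/-- The Galois map `a ⊗_A b ↦ a b₀ ⊗_A b₁` from `B ⊗_A B` to `B ⊗_A H` (legs of `ρ_R`) is
well defined and bijective. -/
def GaloisMapRBijective (ρ : ComoduleAlgebra 𝓗 ι) : Prop :=
  ∃ gal : Bal (rightMul (AlgHom.op ι)) (leftMul ι) ≃ₗ[k]
      Bal (rightMul (AlgHom.op ι)) 𝓗.right.actL,
    ∀ a b u, Bal.mk _ _ u = ρ.coactR b →
      gal (Bal.mk _ _ (a ⊗ₜ b)) = Bal.mk _ _ ((a ⊗ₜ 1) * u)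

/-- The Galois map `a ⊗_A b ↦ a₀ b ⊗_L a₁` from `B ⊗_A B` to `B ⊗_L H` (legs of `ρ_L`) is
well defined and bijective. -/
def GaloisMapLBijective (ρ : ComoduleAlgebra 𝓗 ι) : Prop :=
  ∃ gal : Bal (rightMul (AlgHom.op ι)) (leftMul ι) ≃ₗ[k] Bal ρ.actL 𝓗.left.actL,
    ∀ a b u, Bal.mk _ _ u = ρ.coactL a →
      gal (Bal.mk _ _ (a ⊗ₜ b)) = Bal.mk _ _ (u * (b ⊗ₜ 1))

/-- `(B, 𝓗)` is a local (finite, Galois) noncommutative covering of `A`: the Hopf algebroid `𝓗` is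
over `A`, and the `A`-ring structure of the comodule algebra `B` is the inclusion `ι : A → B`. -/
structure IsLocalCovering (ρ : ComoduleAlgebra 𝓗 ι) : Prop where
  injective : Function.Injective ι
  antipode_bijective : Function.Bijective 𝓗.antipode
  fgProjective_right_actL : IsFGProjective 𝓗.right.actL
  fgProjective_right_actR : IsFGProjective 𝓗.right.actR
  fgProjective_left_actL : IsFGProjective 𝓗.left.actL
  fgProjective_left_actR : IsFGProjective 𝓗.left.actR
  fgProjective : IsFGProjective (leftMul ι)
  coinvariants_R : {b | ρ.coactR b = Bal.mk _ _ (b ⊗ₜ 1)} = Set.range ι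
  coinvariants_L : {b | ρ.coactL b = Bal.mk _ _ (b ⊗ₜ 1)} = Set.range ι
  galois_R : GaloisMapRBijective ρ
  galois_L : GaloisMapLBijective ρ

/-- `A` is central in `(B, 𝓗)`: it is central in `B`, and its images under the source and target maps
are central in `H`. (The images of `L` under its source and target maps are the same subalgebras.) -/
structure IsCentralIn (𝓗 : HopfAlgebroid k L A H) (ι : A →ₐ[k] B) : Prop where
  inclusion : ∀ a, ι a ∈ Set.center B
  source : ∀ a, 𝓗.right.source a ∈ Set.center H
  target : ∀ a, 𝓗.right.target (op a) ∈ Set.center H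

end Covering

/-! ### Fibres over a point -/

section Fibre

variable {X : Type u₁} [TopologicalSpace X]

/-- The ideal of `B` generated by the image of `I_x = {f | f x = 0}`. -/
def fibreIdeal {B : Type u₂} [Ring B] [Algebra ℂ B] (ι : C(X, ℂ) →ₐ[ℂ] B) (x : X) :
    TwoSidedIdeal B :=
  TwoSidedIdeal.span (ι '' {f | f x = 0})

/-- The fibre `B / I_x B` at `x` of an algebra `B` over `C(X)`. -/
abbrev Fibre {B : Type u₂} [Ring B] [Algebra ℂ B] (ι : C(X, ℂ) →ₐ[ℂ] B) (x : X) : Type u₂ :=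
  (fibreIdeal ι x).ringCon.Quotient

/-- The projection of `B` onto its fibre at `x`. -/
def toFibre {B : Type u₂} [Ring B] [Algebra ℂ B] (ι : C(X, ℂ) →ₐ[ℂ] B) (x : X) :
    B →ₐ[ℂ] Fibre ι x :=
  { (fibreIdeal ι x).ringCon.mk' with
    commutes' := fun _ => rfl }

end Fibre

end NCCovering

end

/-! Write `θ = ε_R ∘ s_L : L → A`. The heart of the matter is that the coaction leaves no room
between the base maps. The coinvariants of `ρ_R` are `A`, so `ρ_R(a) = a ⊗ 1 = 1 ⊗ t_R(a)`, while
`A`-linearity gives `ρ_R(a) = 1 ⊗ s_R(a)`. Since `H` is projective over `A` and `A` embeds in `B`,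
the map `h ↦ 1 ⊗ h` is injective, so `s_R = t_R` (`IsLocalCovering.source_eq_target`). The Hopf
algebroid axioms then give `s_L(l) = t_L(l) = s_R(θ l)`, and injectivity of `ρ_R` gives `b · l = b
θ(l)` (`IsLocalCovering.actL_apply`). All base algebras thus act through one central copy of `A`.

Consequently every structure map is linear over this copy of `A`, the antipode up to the side on
which `A` multiplies. As the kernels of the projections to the fibres are spanned by products with
elements of `I_x`, every structure map descends. Over the ground field the balanced tensor products
are ordinary ones, so each tensor in a fibre lifts to a representative upstairs and the axioms are
inherited (`coassoc_map`, `exists_representative`).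

The Galois maps and their inverses are `A`-linear, so they induce bijections of fibres
(`exists_equiv_of_isFibreMap`); the same holds for the antipode. Finiteness passes to the fibre
along a semilinear surjection, and Nakayama's lemma shows `E_x ≠ 0`. Coinvariants need not commute
with passage to a quotient, so they are recomputed from the Galois property: if `b` is coinvariant,
then `1 ⊗ b` and `b ⊗ 1` have the same image, hence are equal, which over a field forces `b` to be
scalar. -/

noncomputable section

open scoped TensorProduct
open MulOpposite

namespace NCCovering

/-! ### Functoriality of balanced tensor products. -/

section BalancedMaps

variable {k : Type*} [CommRing k] {R S R' S' M N P M' N' P' : Type*}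
  [Ring R] [Algebra k R] [Ring S] [Algebra k S] [Ring R'] [Algebra k R'] [Ring S'] [Algebra k S']
  [AddCommGroup M] [Module k M] [AddCommGroup N] [Module k N] [AddCommGroup P] [Module k P]
  [AddCommGroup M'] [Module k M'] [AddCommGroup N'] [Module k N'] [AddCommGroup P'] [Module k P']

/-- `f` is equivariant for left actions along `c`. -/
def LeftEquivariant (φ : R →ₐ[k] Module.End k M) (φ' : R' →ₐ[k] Module.End k M')
    (c : R →ₐ[k] R') (f : M →ₗ[k] M') : Prop :=
  ∀ r m, f (φ r m) = φ' (c r) (f m)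

/-- `f` is equivariant for right actions along `c`. -/
def RightEquivariant (ψ : Rᵐᵒᵖ →ₐ[k] Module.End k M) (ψ' : R'ᵐᵒᵖ →ₐ[k] Module.End k M')
    (c : R →ₐ[k] R') (f : M →ₗ[k] M') : Prop :=
  ∀ r m, f (ψ (op r) m) = ψ' (op (c r)) (f m)

variable {ψ : Rᵐᵒᵖ →ₐ[k] Module.End k M} {φ : R →ₐ[k] Module.End k N}
  {ψ₂ : Sᵐᵒᵖ →ₐ[k] Module.End k N} {φ₂ : S →ₐ[k] Module.End k P}
  {ψ' : R'ᵐᵒᵖ →ₐ[k] Module.End k M'} {φ' : R' →ₐ[k] Module.End k N'}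
  {ψ₂' : S'ᵐᵒᵖ →ₐ[k] Module.End k N'} {φ₂' : S' →ₐ[k] Module.End k P'}
  {c : R →ₐ[k] R'} {d : S →ₐ[k] S'} {f : M →ₗ[k] M'} {g : N →ₗ[k] N'} {e : P →ₗ[k] P'}

theorem Bal.mk_smul_tmul (r : R) (m : M) (n : N) :
    Bal.mk ψ φ (ψ (op r) m ⊗ₜ n) = Bal.mk ψ φ (m ⊗ₜ φ r n) :=
  (Submodule.Quotient.eq _).2 (Submodule.subset_span ⟨r, m, n, rfl⟩)

/-- The map of balanced tensor products induced by equivariant maps. -/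
def Bal.map (hf : RightEquivariant ψ ψ' c f) (hg : LeftEquivariant φ φ' c g) :
    Bal ψ φ →ₗ[k] Bal ψ' φ' :=
  (balRel ψ φ).mapQ (balRel ψ' φ') (TensorProduct.map f g) (by
    rw [balRel, Submodule.span_le]
    rintro _ ⟨r, m, n, rfl⟩
    refine Submodule.subset_span ⟨c r, f m, g n, ?_⟩
    simp only [map_sub, TensorProduct.map_tmul, hf r m, hg r n])

@[simp]
theorem Bal.map_mk (hf : RightEquivariant ψ ψ' c f) (hg : LeftEquivariant φ φ' c g)
    (u : M ⊗[k] N) :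
    Bal.map hf hg (Bal.mk ψ φ u) = Bal.mk ψ' φ' (TensorProduct.map f g u) :=
  rfl

theorem Bal.map_eq_zero (hf : RightEquivariant ψ ψ' c f) (hg : LeftEquivariant φ φ' c g)
    {b : Bal ψ φ} (h : ∀ u, Bal.mk ψ φ u = b → TensorProduct.map f g u = 0) :
    Bal.map hf hg b = 0 := by
  obtain ⟨u, rfl⟩ := (balRel ψ φ).mkQ_surjective b
  rw [Bal.map_mk, h u rfl, map_zero]

/-- The map of threefold balanced tensor products induced by equivariant maps. -/
def Bal₃.map (hf : RightEquivariant ψ ψ' c f) (hg : LeftEquivariant φ φ' c g)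
    (hg₂ : RightEquivariant ψ₂ ψ₂' d g) (he : LeftEquivariant φ₂ φ₂' d e) :
    Bal₃ ψ φ ψ₂ φ₂ →ₗ[k] Bal₃ ψ' φ' ψ₂' φ₂' :=
  (balRel₃ ψ φ ψ₂ φ₂).mapQ (balRel₃ ψ' φ' ψ₂' φ₂')
    (TensorProduct.map f (TensorProduct.map g e)) (by
    rw [balRel₃, Submodule.span_le]
    rintro _ (⟨r, m, n, p, rfl⟩ | ⟨s, m, n, p, rfl⟩)
    · refine Submodule.subset_span (Or.inl ⟨c r, f m, g n, e p, ?_⟩)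
      simp only [map_sub, TensorProduct.map_tmul, hf r m, hg r n]
    · refine Submodule.subset_span (Or.inr ⟨d s, f m, g n, e p, ?_⟩)
      simp only [map_sub, TensorProduct.map_tmul, hg₂ s n, he s p])

theorem assocL_mk_tmul (u : M ⊗[k] N) (p : P) :
    assocL ψ φ ψ₂ φ₂ (Bal.mk ψ φ u ⊗ₜ p) =
      (balRel₃ ψ φ ψ₂ φ₂).mkQ (TensorProduct.assoc k M N P (u ⊗ₜ p)) :=
  rfl

theorem map_assocL (hf : RightEquivariant ψ ψ' c f) (hg : LeftEquivariant φ φ' c g)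
    (hg₂ : RightEquivariant ψ₂ ψ₂' d g) (he : LeftEquivariant φ₂ φ₂' d e)
    (z : Bal ψ φ ⊗[k] P) :
    Bal₃.map hf hg hg₂ he (assocL ψ φ ψ₂ φ₂ z) =
      assocL ψ' φ' ψ₂' φ₂' (TensorProduct.map (Bal.map hf hg) e z) := by
  induction z with
  | zero => simp only [map_zero]
  | add x y hx hy => simp only [map_add, hx, hy]
  | tmul b p =>
    obtain ⟨u, rfl⟩ := (balRel ψ φ).mkQ_surjective b
    rw [TensorProduct.map_tmul, Bal.map_mk, assocL_mk_tmul, assocL_mk_tmul]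
    induction u with
    | zero => simp only [map_zero, TensorProduct.zero_tmul]
    | add x y hx hy => simp only [map_add, TensorProduct.add_tmul, hx, hy]
    | tmul m n => rfl

theorem map_assocR (hf : RightEquivariant ψ ψ' c f) (hg : LeftEquivariant φ φ' c g)
    (hg₂ : RightEquivariant ψ₂ ψ₂' d g) (he : LeftEquivariant φ₂ φ₂' d e)
    (z : M ⊗[k] Bal ψ₂ φ₂) :
    Bal₃.map hf hg hg₂ he (assocR ψ φ ψ₂ φ₂ z) =
      assocR ψ' φ' ψ₂' φ₂' (TensorProduct.map f (Bal.map hg₂ he) z) := by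
  induction z with
  | zero => simp only [map_zero]
  | add x y hx hy => simp only [map_add, hx, hy]
  | tmul m b =>
    obtain ⟨u, rfl⟩ := (balRel ψ₂ φ₂).mkQ_surjective b
    rfl

/-- Coassociativity laws are transported along equivariant maps which intertwine the coactions. -/
theorem coassoc_map {M₀ M₀' P₀ P₀' : Type*} [AddCommGroup M₀] [Module k M₀]
    [AddCommGroup M₀'] [Module k M₀'] [AddCommGroup P₀] [Module k P₀]
    [AddCommGroup P₀'] [Module k P₀']
    {D : M₀ →ₗ[k] Bal ψ φ} {D' : M₀' →ₗ[k] Bal ψ' φ'}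
    {E : P₀ →ₗ[k] Bal ψ₂ φ₂} {E' : P₀' →ₗ[k] Bal ψ₂' φ₂'}
    {q : M₀ →ₗ[k] M₀'} {q' : P₀ →ₗ[k] P₀'}
    (hf : RightEquivariant ψ ψ' c f) (hg : LeftEquivariant φ φ' c g)
    (hg₂ : RightEquivariant ψ₂ ψ₂' d g) (he : LeftEquivariant φ₂ φ₂' d e)
    (hD : ∀ m, D' (q m) = Bal.map hf hg (D m)) (hE : ∀ p, E' (q' p) = Bal.map hg₂ he (E p))
    {u : M₀ ⊗[k] P} {v : M ⊗[k] P₀}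
    (h : assocL ψ φ ψ₂ φ₂ (D.rTensor P u) = assocR ψ φ ψ₂ φ₂ (E.lTensor M v)) :
    assocL ψ' φ' ψ₂' φ₂' (D'.rTensor P' (TensorProduct.map q e u)) =
      assocR ψ' φ' ψ₂' φ₂' (E'.lTensor M' (TensorProduct.map f q' v)) := by
  have hu : D'.rTensor P' (TensorProduct.map q e u) =
      TensorProduct.map (Bal.map hf hg) e (D.rTensor P u) := by
    rw [LinearMap.rTensor, LinearMap.rTensor, ← LinearMap.comp_apply, ← LinearMap.comp_apply,
      ← TensorProduct.map_comp, ← TensorProduct.map_comp]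
    congr 2
    exact LinearMap.ext hD
  have hv : E'.lTensor M' (TensorProduct.map f q' v) =
      TensorProduct.map f (Bal.map hg₂ he) (E.lTensor M v) := by
    rw [LinearMap.lTensor, LinearMap.lTensor, ← LinearMap.comp_apply, ← LinearMap.comp_apply,
      ← TensorProduct.map_comp, ← TensorProduct.map_comp]
    congr 2
    exact LinearMap.ext hE
  rw [hu, hv, ← map_assocL hf hg hg₂ he, ← map_assocR hf hg hg₂ he, h]

end BalancedMaps

/-! ### Balancing over the ground ring. -/

section Scalars

variable {k : Type*} [CommRing k] {M N : Type*}
  [AddCommGroup M] [Module k M] [AddCommGroup N] [Module k N]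

/-- The structure map `kᵐᵒᵖ → A` of a `k`-algebra. -/
def opScalar (k A : Type*) [CommRing k] [Ring A] [Algebra k A] : kᵐᵒᵖ →ₐ[k] A :=
  (Algebra.ofId k A).comp (AlgEquiv.toOpposite k k).symm.toAlgHom

@[simp]
theorem opScalar_op {A : Type*} [Ring A] [Algebra k A] (r : k) :
    opScalar k A (op r) = algebraMap k A r :=
  rfl

theorem algHom_op_eq {A : Type*} [Ring A] [Algebra k A] (ψ : kᵐᵒᵖ →ₐ[k] A) (r : k) :
    ψ (op r) = algebraMap k A r :=
  ψ.commutes r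

theorem algHom_eq {A : Type*} [Ring A] [Algebra k A] (φ : k →ₐ[k] A) (r : k) :
    φ r = algebraMap k A r :=
  φ.commutes r

theorem balRel_eq_bot (ψ : kᵐᵒᵖ →ₐ[k] Module.End k M) (φ : k →ₐ[k] Module.End k N) :
    balRel ψ φ = ⊥ := by
  rw [balRel, Submodule.span_eq_bot]
  rintro _ ⟨r, m, n, rfl⟩
  rw [algHom_op_eq, algHom_eq, Module.algebraMap_end_apply, Module.algebraMap_end_apply,
    TensorProduct.smul_tmul, sub_self]

/-- The only action of `k` by a `k`-algebra map is scalar multiplication, so the balancing relations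
already hold in `M ⊗[k] N`. On the fibres, where both base algebras are `k`, a value of a coaction
therefore has exactly one representative. -/
theorem Bal.mk_injective (ψ : kᵐᵒᵖ →ₐ[k] Module.End k M) (φ : k →ₐ[k] Module.End k N) :
    Function.Injective (Bal.mk ψ φ) := by
  rw [← LinearMap.ker_eq_bot, Submodule.ker_mkQ, balRel_eq_bot]

end Scalars

/-! ### Factoring linear maps through surjections. -/

section Descent

variable {k : Type*} [CommRing k] {M M' N : Type*} [AddCommGroup M] [Module k M]
  [AddCommGroup M'] [Module k M'] [AddCommGroup N] [Module k N]

/-- The factorization of `f` through the surjective map `p`. -/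
def descend (p : M →ₗ[k] M') (hp : Function.Surjective p) (f : M →ₗ[k] N)
    (hf : ∀ m, p m = 0 → f m = 0) : M' →ₗ[k] N :=
  (LinearMap.ker p).liftQ f hf ∘ₗ (p.quotKerEquivOfSurjective hp).symm.toLinearMap

@[simp]
theorem descend_apply (p : M →ₗ[k] M') (hp : Function.Surjective p) (f : M →ₗ[k] N)
    (hf : ∀ m, p m = 0 → f m = 0) (m : M) : descend p hp f hf (p m) = f m := by
  have h : (p.quotKerEquivOfSurjective hp).symm (p m) = (LinearMap.ker p).mkQ m := by
    rw [LinearEquiv.symm_apply_eq]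
    rfl
  rw [descend, LinearMap.comp_apply, LinearEquiv.coe_coe, h]
  rfl

end Descent

/-! ### Products and scalars in tensor products of algebras. -/

section AlgebraTensor

variable {k : Type*} [CommRing k] {A B A' B' : Type*} [Ring A] [Algebra k A] [Ring B] [Algebra k B]
  [Ring A'] [Algebra k A'] [Ring B'] [Algebra k B']

theorem map_tensor_mul (f : A →ₐ[k] A') (g : B →ₐ[k] B') (u v : A ⊗[k] B) :
    TensorProduct.map f.toLinearMap g.toLinearMap (u * v) =
      TensorProduct.map f.toLinearMap g.toLinearMap u *
        TensorProduct.map f.toLinearMap g.toLinearMap v :=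
  map_mul (Algebra.TensorProduct.map f g) u v

theorem algebraMap_tmul_algebraMap (r s : k) :
    (algebraMap k A r ⊗ₜ[k] algebraMap k B s) = algebraMap k (A ⊗[k] B) (r * s) := by
  rw [Algebra.algebraMap_eq_smul_one, Algebra.algebraMap_eq_smul_one, TensorProduct.smul_tmul_smul,
    Algebra.algebraMap_eq_smul_one, Algebra.TensorProduct.one_def]

theorem algebraMap_tmul_one (r : k) :
    (algebraMap k A r ⊗ₜ[k] (1 : B)) = algebraMap k (A ⊗[k] B) r := by
  rw [← map_one (algebraMap k B), algebraMap_tmul_algebraMap, mul_one]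

theorem one_tmul_algebraMap (r : k) :
    ((1 : A) ⊗ₜ[k] algebraMap k B r) = algebraMap k (A ⊗[k] B) r := by
  rw [← map_one (algebraMap k A), algebraMap_tmul_algebraMap, one_mul]

end AlgebraTensor

/-! ### Lifting representatives from the fibre. -/

section Representatives

variable {k : Type*} [CommRing k] {R M N M' N' M₀ M₀' : Type*} [Ring R] [Algebra k R]
  [AddCommGroup M] [Module k M] [AddCommGroup N] [Module k N]
  [AddCommGroup M'] [Module k M'] [AddCommGroup N'] [Module k N']
  [AddCommGroup M₀] [Module k M₀] [AddCommGroup M₀'] [Module k M₀']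
  {ψ : Rᵐᵒᵖ →ₐ[k] Module.End k M} {φ : R →ₐ[k] Module.End k N}
  {ψ' : kᵐᵒᵖ →ₐ[k] Module.End k M'} {φ' : k →ₐ[k] Module.End k N'}
  {χ : R →ₐ[k] k} {f : M →ₗ[k] M'} {g : N →ₗ[k] N'}

theorem rightEquivariant_of_smul (ψ' : kᵐᵒᵖ →ₐ[k] Module.End k M')
    (h : ∀ r m, f (ψ (op r) m) = χ r • f m) : RightEquivariant ψ ψ' χ f := by
  intro r m
  rw [h, algHom_op_eq, Module.algebraMap_end_apply]

theorem leftEquivariant_of_smul (φ' : k →ₐ[k] Module.End k N')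
    (h : ∀ r n, g (φ r n) = χ r • g n) : LeftEquivariant φ φ' χ g := by
  intro r m
  rw [h, algHom_eq, Module.algebraMap_end_apply]

/-- An element of a tensor product over the ground ring lifts to a representative of a value of
the coaction `D`. -/
theorem exists_representative {hf : RightEquivariant ψ ψ' χ f} {hg : LeftEquivariant φ φ' χ g}
    {D : M₀ →ₗ[k] Bal ψ φ} {D' : M₀' →ₗ[k] Bal ψ' φ'} {q : M₀ →ₗ[k] M₀'}
    (hD : ∀ m, D' (q m) = Bal.map hf hg (D m)) {m : M₀} {u' : M' ⊗[k] N'}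
    (hu : Bal.mk ψ' φ' u' = D' (q m)) :
    ∃ u, Bal.mk ψ φ u = D m ∧ TensorProduct.map f g u = u' := by
  obtain ⟨u, hu₀⟩ := (balRel ψ φ).mkQ_surjective (D m)
  -- Any representative of `D m` will do: its image represents `D' (q m)`, and over `k` the
  -- representative is unique.
  refine ⟨u, hu₀, Bal.mk_injective ψ' φ' ?_⟩
  rw [hu, hD, ← Bal.map_mk hf hg]
  exact congrArg _ hu₀

end Representatives

/-! ### Descent of bialgebroids, Hopf algebroids and comodule algebras along a character. -/

section Fibres

variable {k : Type*} [CommRing k] {L R H H' M M' : Type*} [Ring L] [Algebra k L]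
  [Ring R] [Algebra k R] [Ring H] [Algebra k H] [Ring H'] [Algebra k H']
  [Ring M] [Algebra k M] [Ring M'] [Algebra k M']

/-- The structure maps of a left bialgebroid descend along the surjection `π` and the character `χ`
of the base algebra. -/
structure LeftBialgebroid.Descends (𝓑 : LeftBialgebroid k L H) (χ : L →ₐ[k] k)
    (π : H →ₐ[k] H') : Prop where
  surjective : Function.Surjective π
  source : ∀ l, π (𝓑.source l) = algebraMap k H' (χ l)
  target : ∀ l, π (𝓑.target (op l)) = algebraMap k H' (χ l)
  counit : ∀ h, π h = 0 → χ (𝓑.counit h) = 0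
  comul : ∀ h u, π h = 0 → Bal.mk _ _ u = 𝓑.comul h →
    TensorProduct.map π.toLinearMap π.toLinearMap u = 0

/-- The structure maps of a right bialgebroid descend along the surjection `π` and the character `χ`
of the base algebra. -/
structure RightBialgebroid.Descends (𝓑 : RightBialgebroid k R H) (χ : R →ₐ[k] k)
    (π : H →ₐ[k] H') : Prop where
  surjective : Function.Surjective π
  source : ∀ r, π (𝓑.source r) = algebraMap k H' (χ r)
  target : ∀ r, π (𝓑.target (op r)) = algebraMap k H' (χ r)
  counit : ∀ h, π h = 0 → χ (𝓑.counit h) = 0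
  comul : ∀ h u, π h = 0 → Bal.mk _ _ u = 𝓑.comul h →
    TensorProduct.map π.toLinearMap π.toLinearMap u = 0

namespace LeftBialgebroid.Descends

variable {𝓑 : LeftBialgebroid k L H} {χ : L →ₐ[k] k} {π : H →ₐ[k] H'} (h𝓑 : 𝓑.Descends χ π)
include h𝓑

theorem actR : RightEquivariant 𝓑.actR (leftMul (opScalar k H')) χ π.toLinearMap :=
  rightEquivariant_of_smul _ fun l h => by
    simp [leftMul, h𝓑.target, Algebra.smul_def]

theorem actL : LeftEquivariant 𝓑.actL (leftMul (Algebra.ofId k H')) χ π.toLinearMap :=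
  leftEquivariant_of_smul _ fun l h => by
    simp [leftMul, h𝓑.source, Algebra.smul_def]

/-- The coproduct of the fibre. -/
def fibreComul : H' →ₗ[k] Bal (leftMul (opScalar k H')) (leftMul (Algebra.ofId k H')) :=
  descend π.toLinearMap h𝓑.surjective (Bal.map h𝓑.actR h𝓑.actL ∘ₗ 𝓑.comul) fun h hh =>
    Bal.map_eq_zero h𝓑.actR h𝓑.actL fun u hu => h𝓑.comul h u hh hu

theorem fibreComul_apply (h : H) :
    h𝓑.fibreComul (π.toLinearMap h) = Bal.map h𝓑.actR h𝓑.actL (𝓑.comul h) :=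
  descend_apply _ _ _ _ h

/-- The counit of the fibre. -/
def fibreCounit : H' →ₗ[k] k :=
  descend π.toLinearMap h𝓑.surjective (χ.toLinearMap ∘ₗ 𝓑.counit) h𝓑.counit

theorem fibreCounit_apply (h : H) : h𝓑.fibreCounit (π h) = χ (𝓑.counit h) :=
  descend_apply π.toLinearMap h𝓑.surjective (χ.toLinearMap ∘ₗ 𝓑.counit) h𝓑.counit h

theorem exists_rep {h : H} {u' : H' ⊗[k] H'} (hu : Bal.mk _ _ u' = h𝓑.fibreComul (π h)) :
    ∃ u, Bal.mk _ _ u = 𝓑.comul h ∧ TensorProduct.map π.toLinearMap π.toLinearMap u = u' :=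
  exists_representative (q := π.toLinearMap) h𝓑.fibreComul_apply hu

/-- The fibre of a left bialgebroid at a character of its base algebra. -/
def fibre : LeftBialgebroid k k H' where
  source := Algebra.ofId k H'
  target := opScalar k H'
  source_target_comm l l' := (Algebra.commutes l _)
  comul := h𝓑.fibreComul
  counit := h𝓑.fibreCounit
  comul_bimodule l l' h u hu := by
    rw [opScalar_op, Algebra.ofId_apply, ← map_mul, algebraMap_tmul_algebraMap,
      ← Algebra.smul_def, ← Algebra.smul_def, map_smul, map_smul, hu]
  counit_bimodule l l' h := by
    rw [opScalar_op, Algebra.ofId_apply, ← map_mul, ← Algebra.smul_def, map_smul, smul_eq_mul]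
    ring
  coassoc h' u' hu' := by
    -- The pattern for the axioms involving a coproduct or coaction: lift the element, lift its
    -- representative, and apply the axiom upstairs.
    obtain ⟨h, rfl⟩ := h𝓑.surjective h'
    obtain ⟨u, hu, rfl⟩ := h𝓑.exists_rep hu'
    exact coassoc_map h𝓑.actR h𝓑.actL h𝓑.actR h𝓑.actL h𝓑.fibreComul_apply h𝓑.fibreComul_apply
      (𝓑.coassoc h u hu)
  counit_left h' u' hu' := by
    obtain ⟨h, rfl⟩ := h𝓑.surjective h'
    obtain ⟨u, hu, rfl⟩ := h𝓑.exists_rep hu'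
    conv_rhs => rw [← 𝓑.counit_left h u hu]
    clear hu hu'
    induction u with
    | zero => simp only [map_zero]
    | add x y hx hy => simp only [map_add, hx, hy]
    | tmul a b => simp [h𝓑.fibreCounit_apply, h𝓑.source, Algebra.ofId_apply]
  counit_right h' u' hu' := by
    obtain ⟨h, rfl⟩ := h𝓑.surjective h'
    obtain ⟨u, hu, rfl⟩ := h𝓑.exists_rep hu'
    conv_rhs => rw [← 𝓑.counit_right h u hu]
    clear hu hu'
    induction u with
    | zero => simp only [map_zero]
    | add x y hx hy => simp only [map_add, hx, hy]
    | tmul a b => simp [h𝓑.fibreCounit_apply, h𝓑.target]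
  takeuchi l h u hu := by
    rw [opScalar_op, Algebra.ofId_apply, algebraMap_tmul_one, one_tmul_algebraMap]
  comul_one := by
    rw [← map_one π]
    refine (h𝓑.fibreComul_apply 1).trans ?_
    rw [𝓑.comul_one]
    rfl
  comul_mul g' h' u' v' hu' hv' := by
    obtain ⟨g, rfl⟩ := h𝓑.surjective g'
    obtain ⟨h, rfl⟩ := h𝓑.surjective h'
    obtain ⟨u, hu, rfl⟩ := h𝓑.exists_rep hu'
    obtain ⟨v, hv, rfl⟩ := h𝓑.exists_rep hv'
    rw [← map_mul]
    refine (h𝓑.fibreComul_apply (g * h)).trans ?_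
    rw [𝓑.comul_mul g h u v hu hv, ← map_tensor_mul]
    rfl
  counit_one := by rw [← map_one π, h𝓑.fibreCounit_apply, 𝓑.counit_one, map_one]
  counit_mul g' h' := by
    obtain ⟨g, rfl⟩ := h𝓑.surjective g'
    obtain ⟨h, rfl⟩ := h𝓑.surjective h'
    rw [← map_mul, h𝓑.fibreCounit_apply, h𝓑.fibreCounit_apply, 𝓑.counit_mul, Algebra.ofId_apply,
      ← h𝓑.source, ← map_mul, h𝓑.fibreCounit_apply]

end LeftBialgebroid.Descends

namespace RightBialgebroid.Descends

variable {𝓑 : RightBialgebroid k R H} {χ : R →ₐ[k] k} {π : H →ₐ[k] H'} (h𝓑 : 𝓑.Descends χ π)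
include h𝓑

theorem actR : RightEquivariant 𝓑.actR (rightMul (AlgHom.op (Algebra.ofId k H'))) χ
    π.toLinearMap :=
  rightEquivariant_of_smul _ fun l h => by
    simp [rightMul, h𝓑.source, Algebra.smul_def, Algebra.commutes]

theorem actL : LeftEquivariant 𝓑.actL (rightMul (AlgHom.opComm.symm (opScalar k H'))) χ
    π.toLinearMap :=
  leftEquivariant_of_smul _ fun l h => by
    simp [rightMul, AlgHom.opComm, h𝓑.target, Algebra.smul_def, Algebra.commutes]

/-- The coproduct of the fibre. -/
def fibreComul : H' →ₗ[k] Bal (rightMul (AlgHom.op (Algebra.ofId k H')))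
    (rightMul (AlgHom.opComm.symm (opScalar k H'))) :=
  descend π.toLinearMap h𝓑.surjective (Bal.map h𝓑.actR h𝓑.actL ∘ₗ 𝓑.comul) fun h hh =>
    Bal.map_eq_zero h𝓑.actR h𝓑.actL fun u hu => h𝓑.comul h u hh hu

theorem fibreComul_apply (h : H) :
    h𝓑.fibreComul (π.toLinearMap h) = Bal.map h𝓑.actR h𝓑.actL (𝓑.comul h) :=
  descend_apply _ _ _ _ h

/-- The counit of the fibre. -/
def fibreCounit : H' →ₗ[k] k :=
  descend π.toLinearMap h𝓑.surjective (χ.toLinearMap ∘ₗ 𝓑.counit) h𝓑.counit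

theorem fibreCounit_apply (h : H) : h𝓑.fibreCounit (π h) = χ (𝓑.counit h) :=
  descend_apply π.toLinearMap h𝓑.surjective (χ.toLinearMap ∘ₗ 𝓑.counit) h𝓑.counit h

theorem exists_rep {h : H} {u' : H' ⊗[k] H'} (hu : Bal.mk _ _ u' = h𝓑.fibreComul (π h)) :
    ∃ u, Bal.mk _ _ u = 𝓑.comul h ∧ TensorProduct.map π.toLinearMap π.toLinearMap u = u' :=
  exists_representative (q := π.toLinearMap) h𝓑.fibreComul_apply hu

/-- The fibre of a right bialgebroid at a character of its base algebra. -/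
def fibre : RightBialgebroid k k H' where
  source := Algebra.ofId k H'
  target := opScalar k H'
  source_target_comm l l' := (Algebra.commutes l _)
  comul := h𝓑.fibreComul
  counit := h𝓑.fibreCounit
  comul_bimodule r r' h u hu := by
    rw [opScalar_op, Algebra.ofId_apply, mul_assoc, ← map_mul, algebraMap_tmul_algebraMap,
      ← Algebra.commutes, ← Algebra.commutes, ← Algebra.smul_def, ← Algebra.smul_def, map_smul,
      map_smul, hu, mul_comm]
  counit_bimodule r r' h := by
    rw [opScalar_op, Algebra.ofId_apply, mul_assoc, ← map_mul, ← Algebra.commutes,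
      ← Algebra.smul_def, map_smul, smul_eq_mul]
    ring
  coassoc h' u' hu' := by
    obtain ⟨h, rfl⟩ := h𝓑.surjective h'
    obtain ⟨u, hu, rfl⟩ := h𝓑.exists_rep hu'
    exact coassoc_map h𝓑.actR h𝓑.actL h𝓑.actR h𝓑.actL h𝓑.fibreComul_apply h𝓑.fibreComul_apply
      (𝓑.coassoc h u hu)
  counit_left h' u' hu' := by
    obtain ⟨h, rfl⟩ := h𝓑.surjective h'
    obtain ⟨u, hu, rfl⟩ := h𝓑.exists_rep hu'
    conv_rhs => rw [← 𝓑.counit_left h u hu]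
    clear hu hu'
    induction u with
    | zero => simp only [map_zero]
    | add x y hx hy => simp only [map_add, hx, hy]
    | tmul a b => simp [h𝓑.fibreCounit_apply, h𝓑.target]
  counit_right h' u' hu' := by
    obtain ⟨h, rfl⟩ := h𝓑.surjective h'
    obtain ⟨u, hu, rfl⟩ := h𝓑.exists_rep hu'
    conv_rhs => rw [← 𝓑.counit_right h u hu]
    clear hu hu'
    induction u with
    | zero => simp only [map_zero]
    | add x y hx hy => simp only [map_add, hx, hy]
    | tmul a b => simp [h𝓑.fibreCounit_apply, h𝓑.source, Algebra.ofId_apply]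
  takeuchi r h u hu := by
    rw [opScalar_op, Algebra.ofId_apply, algebraMap_tmul_one, one_tmul_algebraMap]
  comul_one := by
    rw [← map_one π]
    refine (h𝓑.fibreComul_apply 1).trans ?_
    rw [𝓑.comul_one]
    rfl
  comul_mul g' h' u' v' hu' hv' := by
    obtain ⟨g, rfl⟩ := h𝓑.surjective g'
    obtain ⟨h, rfl⟩ := h𝓑.surjective h'
    obtain ⟨u, hu, rfl⟩ := h𝓑.exists_rep hu'
    obtain ⟨v, hv, rfl⟩ := h𝓑.exists_rep hv'
    rw [← map_mul]
    refine (h𝓑.fibreComul_apply (g * h)).trans ?_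
    rw [𝓑.comul_mul g h u v hu hv, ← map_tensor_mul]
    rfl
  counit_one := by rw [← map_one π, h𝓑.fibreCounit_apply, 𝓑.counit_one, map_one]
  counit_mul g' h' := by
    obtain ⟨g, rfl⟩ := h𝓑.surjective g'
    obtain ⟨h, rfl⟩ := h𝓑.surjective h'
    rw [← map_mul, h𝓑.fibreCounit_apply, h𝓑.fibreCounit_apply, 𝓑.counit_mul, Algebra.ofId_apply,
      ← h𝓑.source, ← map_mul, h𝓑.fibreCounit_apply]

end RightBialgebroid.Descends

/-- The structure maps of a Hopf algebroid descend along the surjection `π` and the characters `χL`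
and `χR` of the base algebras. -/
structure HopfAlgebroid.Descends (𝓗 : HopfAlgebroid k L R H) (χL : L →ₐ[k] k) (χR : R →ₐ[k] k)
    (π : H →ₐ[k] H') : Prop where
  left : 𝓗.left.Descends χL π
  right : 𝓗.right.Descends χR π
  antipode : ∀ h, π h = 0 → π (𝓗.antipode h) = 0

namespace HopfAlgebroid.Descends

variable {𝓗 : HopfAlgebroid k L R H} {χL : L →ₐ[k] k} {χR : R →ₐ[k] k} {π : H →ₐ[k] H'}
  (h𝓗 : 𝓗.Descends χL χR π)
include h𝓗

/-- The antipode of the fibre. -/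
def fibreAntipode : H' →ₗ[k] H' :=
  descend π.toLinearMap h𝓗.left.surjective (π.toLinearMap ∘ₗ 𝓗.antipode) h𝓗.antipode

theorem fibreAntipode_apply (h : H) : h𝓗.fibreAntipode (π h) = π (𝓗.antipode h) :=
  descend_apply π.toLinearMap h𝓗.left.surjective (π.toLinearMap ∘ₗ 𝓗.antipode) h𝓗.antipode h

/-- The fibre of a Hopf algebroid at a pair of characters of its base algebras. -/
def fibre : HopfAlgebroid k k k H' where
  left := h𝓗.left.fibre
  right := h𝓗.right.fibre
  antipode := h𝓗.fibreAntipode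
  -- On the fibre every source and target map is the structure map of the algebra, so the four
  -- compatibilities reduce to `ε(r · 1) = r`.
  sL_εL_tR r := congrArg (algebraMap k H') (by
    refine (congrArg h𝓗.left.fibre.counit (Algebra.algebraMap_eq_smul_one (A := H') r)).trans ?_
    rw [map_smul, h𝓗.left.fibre.counit_one, smul_eq_mul, mul_one]
    rfl)
  tR_εR_sL r := congrArg (algebraMap k H') (by
    refine (congrArg h𝓗.right.fibre.counit (Algebra.algebraMap_eq_smul_one (A := H') r)).trans ?_
    rw [map_smul, h𝓗.right.fibre.counit_one, smul_eq_mul, mul_one])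
  tL_εL_sR r := congrArg (algebraMap k H') (by
    refine (congrArg h𝓗.left.fibre.counit (Algebra.algebraMap_eq_smul_one (A := H') r)).trans ?_
    rw [map_smul, h𝓗.left.fibre.counit_one, smul_eq_mul, mul_one])
  sR_εR_tL r := congrArg (algebraMap k H') (by
    refine (congrArg h𝓗.right.fibre.counit (Algebra.algebraMap_eq_smul_one (A := H') r)).trans ?_
    rw [map_smul, h𝓗.right.fibre.counit_one, smul_eq_mul, mul_one]
    rfl)
  coassoc_LR h' u' v' hu' hv' := by
    obtain ⟨h, rfl⟩ := h𝓗.left.surjective h'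
    obtain ⟨u, hu, rfl⟩ := h𝓗.right.exists_rep hu'
    obtain ⟨v, hv, rfl⟩ := h𝓗.left.exists_rep hv'
    exact coassoc_map h𝓗.left.actR h𝓗.left.actL h𝓗.right.actR h𝓗.right.actL
      h𝓗.left.fibreComul_apply h𝓗.right.fibreComul_apply (𝓗.coassoc_LR h u v hu hv)
  coassoc_RL h' u' v' hu' hv' := by
    obtain ⟨h, rfl⟩ := h𝓗.left.surjective h'
    obtain ⟨u, hu, rfl⟩ := h𝓗.left.exists_rep hu'
    obtain ⟨v, hv, rfl⟩ := h𝓗.right.exists_rep hv'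
    exact coassoc_map h𝓗.right.actR h𝓗.right.actL h𝓗.left.actR h𝓗.left.actL
      h𝓗.right.fibreComul_apply h𝓗.left.fibreComul_apply (𝓗.coassoc_RL h u v hu hv)
  antipode_mul l r h := by
    change h𝓗.fibreAntipode (algebraMap k H' l * h * algebraMap k H' r) =
      algebraMap k H' r * h𝓗.fibreAntipode h * algebraMap k H' l
    rw [← Algebra.commutes, ← Algebra.commutes l (_ * _)]
    simp only [← Algebra.smul_def, map_smul]
    rw [smul_comm]
  antipode_left h' u' hu' := by
    obtain ⟨h, rfl⟩ := h𝓗.left.surjective h'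
    obtain ⟨u, hu, rfl⟩ := h𝓗.left.exists_rep hu'
    refine Eq.trans ?_ ((congrArg π (𝓗.antipode_left h u hu)).trans ?_)
    · clear hu hu'
      induction u with
      | zero => simp only [map_zero]
      | add x y hx hy => simp only [map_add, hx, hy]
      | tmul a b => simp [h𝓗.fibreAntipode_apply]
    · rw [h𝓗.right.source, ← h𝓗.right.fibreCounit_apply]
      rfl
  antipode_right h' u' hu' := by
    obtain ⟨h, rfl⟩ := h𝓗.left.surjective h'
    obtain ⟨u, hu, rfl⟩ := h𝓗.right.exists_rep hu'
    refine Eq.trans ?_ ((congrArg π (𝓗.antipode_right h u hu)).trans ?_)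
    · clear hu hu'
      induction u with
      | zero => simp only [map_zero]
      | add x y hx hy => simp only [map_add, hx, hy]
      | tmul a b => simp [h𝓗.fibreAntipode_apply]
    · rw [h𝓗.left.source, ← h𝓗.left.fibreCounit_apply]
      rfl

theorem isGeometricHom : 𝓗.IsGeometricHom h𝓗.fibre χL χR π where
  source_left := h𝓗.left.source
  target_left := h𝓗.left.target
  counit_left := h𝓗.left.fibreCounit_apply
  source_right := h𝓗.right.source
  target_right := h𝓗.right.target
  counit_right := h𝓗.right.fibreCounit_apply
  comul_left h u hu := by
    refine (h𝓗.left.fibreComul_apply h).trans ?_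
    rw [← hu]
    rfl
  comul_right h u hu := by
    refine (h𝓗.right.fibreComul_apply h).trans ?_
    rw [← hu]
    rfl
  antipode h := (h𝓗.fibreAntipode_apply h).symm

end HopfAlgebroid.Descends

/-- The structure maps of a comodule algebra descend along the surjection `p`. -/
structure ComoduleAlgebra.Descends {𝓗 : HopfAlgebroid k L R H} {η : R →ₐ[k] M}
    (ρ : ComoduleAlgebra 𝓗 η) (χL : L →ₐ[k] k) (χR : R →ₐ[k] k) (π : H →ₐ[k] H')
    (p : M →ₐ[k] M') : Prop where
  surjective : Function.Surjective p
  unit : ∀ r, p (η r) = algebraMap k M' (χR r)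
  actL : ∀ l m, p (ρ.actL (op l) m) = χL l • p m
  coactR : ∀ m u, p m = 0 → Bal.mk _ _ u = ρ.coactR m →
    TensorProduct.map p.toLinearMap π.toLinearMap u = 0
  coactL : ∀ m u, p m = 0 → Bal.mk _ _ u = ρ.coactL m →
    TensorProduct.map p.toLinearMap π.toLinearMap u = 0

namespace ComoduleAlgebra.Descends

variable {𝓗 : HopfAlgebroid k L R H} {η : R →ₐ[k] M} {ρ : ComoduleAlgebra 𝓗 η}
  {χL : L →ₐ[k] k} {χR : R →ₐ[k] k} {π : H →ₐ[k] H'} {p : M →ₐ[k] M'}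
  (hρ : ρ.Descends χL χR π p) (h𝓗 : 𝓗.Descends χL χR π)
include hρ

theorem equivariantR : RightEquivariant (rightMul (AlgHom.op η))
    (rightMul (AlgHom.op (Algebra.ofId k M'))) χR p.toLinearMap :=
  rightEquivariant_of_smul _ fun l h => by
    simp [rightMul, hρ.unit, Algebra.smul_def, Algebra.commutes]

theorem equivariantL : RightEquivariant ρ.actL (opScalar k (Module.End k M')) χL
    p.toLinearMap :=
  rightEquivariant_of_smul _ hρ.actL

include h𝓗

/-- The coaction of the right bialgebroid on the fibre. -/
def fibreCoactR : M' →ₗ[k] Bal (rightMul (AlgHom.op (Algebra.ofId k M'))) h𝓗.fibre.right.actL :=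
  descend p.toLinearMap hρ.surjective (Bal.map hρ.equivariantR h𝓗.right.actL ∘ₗ ρ.coactR)
    fun m hm => Bal.map_eq_zero hρ.equivariantR h𝓗.right.actL fun u hu => hρ.coactR m u hm hu

theorem fibreCoactR_apply (m : M) : hρ.fibreCoactR h𝓗 (p.toLinearMap m) =
    Bal.map hρ.equivariantR h𝓗.right.actL (ρ.coactR m) :=
  descend_apply _ _ _ _ m

/-- The coaction of the left bialgebroid on the fibre. -/
def fibreCoactL : M' →ₗ[k] Bal (opScalar k (Module.End k M')) h𝓗.fibre.left.actL :=
  descend p.toLinearMap hρ.surjective (Bal.map hρ.equivariantL h𝓗.left.actL ∘ₗ ρ.coactL)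
    fun m hm => Bal.map_eq_zero hρ.equivariantL h𝓗.left.actL fun u hu => hρ.coactL m u hm hu

theorem fibreCoactL_apply (m : M) : hρ.fibreCoactL h𝓗 (p.toLinearMap m) =
    Bal.map hρ.equivariantL h𝓗.left.actL (ρ.coactL m) :=
  descend_apply _ _ _ _ m

theorem exists_repR {m : M} {u' : M' ⊗[k] H'}
    (hu : Bal.mk _ _ u' = hρ.fibreCoactR h𝓗 (p m)) :
    ∃ u, Bal.mk _ _ u = ρ.coactR m ∧ TensorProduct.map p.toLinearMap π.toLinearMap u = u' :=
  exists_representative (q := p.toLinearMap) (hρ.fibreCoactR_apply h𝓗) hu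

theorem exists_repL {m : M} {u' : M' ⊗[k] H'}
    (hu : Bal.mk _ _ u' = hρ.fibreCoactL h𝓗 (p m)) :
    ∃ u, Bal.mk _ _ u = ρ.coactL m ∧ TensorProduct.map p.toLinearMap π.toLinearMap u = u' :=
  exists_representative (q := p.toLinearMap) (hρ.fibreCoactL_apply h𝓗) hu

/-- The fibre of a comodule algebra. -/
def fibre : ComoduleAlgebra h𝓗.fibre (Algebra.ofId k M') where
  actL := opScalar k (Module.End k M')
  coactR := hρ.fibreCoactR h𝓗
  coactL := hρ.fibreCoactL h𝓗
  coactR_R m r u hu := by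
    change hρ.fibreCoactR h𝓗 (m * algebraMap k M' r) = Bal.mk _ _ (u * (1 ⊗ₜ algebraMap k H' r))
    rw [one_tmul_algebraMap, ← Algebra.commutes, ← Algebra.commutes, ← Algebra.smul_def,
      ← Algebra.smul_def, map_smul, map_smul, hu]
  coactR_L m r u hu := by
    change hρ.fibreCoactR h𝓗 (r • m) = Bal.mk _ _ ((1 ⊗ₜ algebraMap k H' r) * u)
    rw [one_tmul_algebraMap, ← Algebra.smul_def, map_smul, map_smul, hu]
  coactL_R m r u hu := by
    change hρ.fibreCoactL h𝓗 (m * algebraMap k M' r) = Bal.mk _ _ (u * (1 ⊗ₜ algebraMap k H' r))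
    rw [one_tmul_algebraMap, ← Algebra.commutes, ← Algebra.commutes, ← Algebra.smul_def,
      ← Algebra.smul_def, map_smul, map_smul, hu]
  coactL_L m r u hu := by
    change hρ.fibreCoactL h𝓗 (r • m) = Bal.mk _ _ ((1 ⊗ₜ algebraMap k H' r) * u)
    rw [one_tmul_algebraMap, ← Algebra.smul_def, map_smul, map_smul, hu]
  coassoc_RR m' u' hu' := by
    obtain ⟨m, rfl⟩ := hρ.surjective m'
    obtain ⟨u, hu, rfl⟩ := hρ.exists_repR h𝓗 hu'
    exact coassoc_map hρ.equivariantR h𝓗.right.actL h𝓗.right.actR h𝓗.right.actL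
      (hρ.fibreCoactR_apply h𝓗) h𝓗.right.fibreComul_apply (ρ.coassoc_RR m u hu)
  coassoc_LL m' u' hu' := by
    obtain ⟨m, rfl⟩ := hρ.surjective m'
    obtain ⟨u, hu, rfl⟩ := hρ.exists_repL h𝓗 hu'
    exact coassoc_map hρ.equivariantL h𝓗.left.actL h𝓗.left.actR h𝓗.left.actL
      (hρ.fibreCoactL_apply h𝓗) h𝓗.left.fibreComul_apply (ρ.coassoc_LL m u hu)
  coassoc_RL m' u' v' hu' hv' := by
    obtain ⟨m, rfl⟩ := hρ.surjective m'
    obtain ⟨u, hu, rfl⟩ := hρ.exists_repL h𝓗 hu'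
    obtain ⟨v, hv, rfl⟩ := hρ.exists_repR h𝓗 hv'
    exact coassoc_map hρ.equivariantR h𝓗.right.actL h𝓗.left.actR h𝓗.left.actL
      (hρ.fibreCoactR_apply h𝓗) h𝓗.left.fibreComul_apply (ρ.coassoc_RL m u v hu hv)
  coassoc_LR m' u' v' hu' hv' := by
    obtain ⟨m, rfl⟩ := hρ.surjective m'
    obtain ⟨u, hu, rfl⟩ := hρ.exists_repR h𝓗 hu'
    obtain ⟨v, hv, rfl⟩ := hρ.exists_repL h𝓗 hv'
    exact coassoc_map hρ.equivariantL h𝓗.left.actL h𝓗.right.actR h𝓗.right.actL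
      (hρ.fibreCoactL_apply h𝓗) h𝓗.right.fibreComul_apply (ρ.coassoc_LR m u v hu hv)
  counit_R m' u' hu' := by
    obtain ⟨m, rfl⟩ := hρ.surjective m'
    obtain ⟨u, hu, rfl⟩ := hρ.exists_repR h𝓗 hu'
    conv_rhs => rw [← ρ.counit_R m u hu]
    clear hu hu'
    induction u with
    | zero => simp only [map_zero]
    | add x y hx hy => simp only [map_add, hx, hy]
    | tmul a b =>
      have hb : h𝓗.fibre.right.counit (π b) = χR (𝓗.right.counit b) :=
        h𝓗.right.fibreCounit_apply b
      simp [hb, hρ.unit, Algebra.ofId_apply]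
  counit_L m' u' hu' := by
    obtain ⟨m, rfl⟩ := hρ.surjective m'
    obtain ⟨u, hu, rfl⟩ := hρ.exists_repL h𝓗 hu'
    conv_rhs => rw [← ρ.counit_L m u hu]
    clear hu hu'
    induction u with
    | zero => simp only [map_zero]
    | add x y hx hy => simp only [map_add, hx, hy]
    | tmul a b =>
      have hb : h𝓗.fibre.left.counit (π b) = χL (𝓗.left.counit b) :=
        h𝓗.left.fibreCounit_apply b
      simp [hb, hρ.actL]
  takeuchi_R m r u hu := by
    change Bal.mk _ _ ((algebraMap k M' r ⊗ₜ 1) * u) = Bal.mk _ _ ((1 ⊗ₜ algebraMap k H' r) * u)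
    rw [algebraMap_tmul_one, one_tmul_algebraMap]
  takeuchi_L m r u hu := by
    change Bal.mk _ _ (u * ((r • (1 : M')) ⊗ₜ 1)) = Bal.mk _ _ (u * (1 ⊗ₜ algebraMap k H' r))
    rw [← Algebra.algebraMap_eq_smul_one, algebraMap_tmul_one, one_tmul_algebraMap]
  coactR_mul m' n' u' v' hu' hv' := by
    obtain ⟨m, rfl⟩ := hρ.surjective m'
    obtain ⟨n, rfl⟩ := hρ.surjective n'
    obtain ⟨u, hu, rfl⟩ := hρ.exists_repR h𝓗 hu'
    obtain ⟨v, hv, rfl⟩ := hρ.exists_repR h𝓗 hv'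
    rw [← map_mul]
    refine (hρ.fibreCoactR_apply h𝓗 (m * n)).trans ?_
    rw [ρ.coactR_mul m n u v hu hv, ← map_tensor_mul]
    rfl
  coactL_mul m' n' u' v' hu' hv' := by
    obtain ⟨m, rfl⟩ := hρ.surjective m'
    obtain ⟨n, rfl⟩ := hρ.surjective n'
    obtain ⟨u, hu, rfl⟩ := hρ.exists_repL h𝓗 hu'
    obtain ⟨v, hv, rfl⟩ := hρ.exists_repL h𝓗 hv'
    rw [← map_mul]
    refine (hρ.fibreCoactL_apply h𝓗 (m * n)).trans ?_
    rw [ρ.coactL_mul m n u v hu hv, ← map_tensor_mul]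
    rfl
  coactR_one := by
    rw [← map_one p]
    refine (hρ.fibreCoactR_apply h𝓗 1).trans ?_
    rw [ρ.coactR_one, Bal.map_mk, TensorProduct.map_tmul, AlgHom.toLinearMap_apply,
      AlgHom.toLinearMap_apply, map_one π]
    rfl
  coactL_one := by
    rw [← map_one p]
    refine (hρ.fibreCoactL_apply h𝓗 1).trans ?_
    rw [ρ.coactL_one, Bal.map_mk, TensorProduct.map_tmul, AlgHom.toLinearMap_apply,
      AlgHom.toLinearMap_apply, map_one π]
    rfl

theorem isCompatible : ρ.IsCompatible (hρ.fibre h𝓗) χL χR π p where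
  unit := hρ.unit
  actL := hρ.actL
  coactR m u hu := by
    refine (hρ.fibreCoactR_apply h𝓗 m).trans ?_
    rw [← hu]
    rfl
  coactL m u hu := by
    refine (hρ.fibreCoactL_apply h𝓗 m).trans ?_
    rw [← hu]
    rfl

end ComoduleAlgebra.Descends

end Fibres

/-! ### Fibres of an `A`-ring at a character, and isomorphisms between them. -/

section FibreMaps

variable {k : Type*} [CommRing k] {A B B' H H' V : Type*} [CommRing A] [Algebra k A]
  [Ring B] [Algebra k B] [Ring B'] [Algebra k B'] [Ring H] [Algebra k H] [Ring H'] [Algebra k H']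
  [AddCommGroup V] [Module k V]

/-- `p` identifies `B'` with the fibre of the `A`-ring `B` at the character `χ` of `A`. -/
structure IsFibreMap (ι : A →ₐ[k] B) (χ : A →ₐ[k] k) (p : B →ₐ[k] B') : Prop where
  surjective : Function.Surjective p
  unit : ∀ a, p (ι a) = algebraMap k B' (χ a)
  ker : ∀ b, p b = 0 → b ∈ Submodule.span k {z | ∃ a b', χ a = 0 ∧ z = ι a * b'}

/-- The workhorse for descent: to see that a linear map kills `ker p`, it suffices to test it on
products `ι a * b` with `χ a = 0`, where `A`-linearity of the structure maps applies. -/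
theorem IsFibreMap.eq_zero {ι : A →ₐ[k] B} {χ : A →ₐ[k] k} {p : B →ₐ[k] B'}
    (hp : IsFibreMap ι χ p) {F : B →ₗ[k] V} (hF : ∀ a b, χ a = 0 → F (ι a * b) = 0)
    {b : B} (hb : p b = 0) : F b = 0 := by
  have h : Submodule.span k {z | ∃ a b', χ a = 0 ∧ z = ι a * b'} ≤ LinearMap.ker F := by
    rw [Submodule.span_le]
    rintro _ ⟨a, b', ha, rfl⟩
    exact hF a b' ha
  exact h (hp.ker b hb)

theorem IsFibreMap.map_mul_eq_zero {ι : A →ₐ[k] B} {χ : A →ₐ[k] k} {p : B →ₐ[k] B'}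
    (hp : IsFibreMap ι χ p) {a : A} (ha : χ a = 0) (b : B) : p (ι a * b) = 0 := by
  rw [map_mul, hp.unit, ha, map_zero, zero_mul]

theorem map_mulLeft_id (b : B) (u : B ⊗[k] H) :
    TensorProduct.map (LinearMap.mulLeft k b) LinearMap.id u = (b ⊗ₜ[k] (1 : H)) * u := by
  induction u with
  | zero => simp only [map_zero, mul_zero]
  | add x y hx hy => simp only [map_add, mul_add, hx, hy]
  | tmul m h => simp

theorem one_tmul_mul_comm {h : H} (hh : ∀ h', h * h' = h' * h) (u : B ⊗[k] H) :
    ((1 : B) ⊗ₜ[k] h) * u = u * (1 ⊗ₜ[k] h) := by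
  induction u with
  | zero => simp only [zero_mul, mul_zero]
  | add x y hx hy => simp only [add_mul, mul_add, hx, hy]
  | tmul m h' => simp [hh]

theorem tmul_one_mul_comm {b : B} (hb : ∀ b', b * b' = b' * b) (u : B ⊗[k] H) :
    (b ⊗ₜ[k] (1 : H)) * u = u * (b ⊗ₜ[k] 1) := by
  induction u with
  | zero => simp only [zero_mul, mul_zero]
  | add x y hx hy => simp only [add_mul, mul_add, hx, hy]
  | tmul m h' => simp [hb]

/-- A linear map on a tensor product which kills `ker p ⊗ H` and `B ⊗ ker π` kills the kernel of
`p ⊗ π`. -/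
theorem eq_zero_of_map_eq_zero {p : B →ₐ[k] B'} {π : H →ₐ[k] H'} (hp : Function.Surjective p)
    (hπ : Function.Surjective π) (F : B ⊗[k] H →ₗ[k] V)
    (h₁ : ∀ b h, p b = 0 → F (b ⊗ₜ h) = 0) (h₂ : ∀ b h, π h = 0 → F (b ⊗ₜ h) = 0)
    {u : B ⊗[k] H} (hu : TensorProduct.map p.toLinearMap π.toLinearMap u = 0) : F u = 0 := by
  have hker : LinearMap.ker (TensorProduct.map p.toLinearMap π.toLinearMap) ≤
      LinearMap.ker F := by
    -- Right exactness: the kernel of `p ⊗ π` is the sum of the images of `B ⊗ ker π` and `ker p ⊗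
    -- H`.
    rw [TensorProduct.map_ker (g := p.toLinearMap) (g' := π.toLinearMap)
      (f := (LinearMap.ker p.toLinearMap).subtype) (f' := (LinearMap.ker π.toLinearMap).subtype)
      (LinearMap.exact_subtype_ker_map _) hp (LinearMap.exact_subtype_ker_map _) hπ]
    refine sup_le ?_ ?_
    · rintro _ ⟨z, rfl⟩
      induction z with
      | zero => simp
      | add x y hx hy => rw [map_add]; exact add_mem hx hy
      | tmul b h => exact h₂ b h.1 h.2
    · rintro _ ⟨z, rfl⟩
      induction z with
      | zero => simp
      | add x y hx hy => rw [map_add]; exact add_mem hx hy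
      | tmul b h => exact h₁ b.1 h b.2
  exact hker hu

/-- A linear isomorphism descends along surjections with matching kernels. -/
theorem exists_equiv_of_ker {V' W W' : Type*} [AddCommGroup V'] [Module k V'] [AddCommGroup W]
    [Module k W] [AddCommGroup W'] [Module k W'] {F₁ : V →ₗ[k] V'} {F₂ : W →ₗ[k] W'}
    (h₁ : Function.Surjective F₁) (h₂ : Function.Surjective F₂) (g : V ≃ₗ[k] W)
    (hg : ∀ v, F₁ v = 0 → F₂ (g v) = 0) (hg' : ∀ w, F₂ w = 0 → F₁ (g.symm w) = 0) :
    ∃ g' : V' ≃ₗ[k] W', ∀ v, g' (F₁ v) = F₂ (g v) := by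
  let G := descend F₁ h₁ (F₂ ∘ₗ g.toLinearMap) hg
  have hG : ∀ v, G (F₁ v) = F₂ (g v) := descend_apply F₁ h₁ (F₂ ∘ₗ g.toLinearMap) hg
  refine ⟨LinearEquiv.ofBijective G ⟨?_, ?_⟩, hG⟩
  · rw [injective_iff_map_eq_zero]
    intro v' hv'
    obtain ⟨v, rfl⟩ := h₁ v'
    rw [hG] at hv'
    simpa using hg' _ hv'
  · intro w'
    obtain ⟨w, rfl⟩ := h₂ w'
    exact ⟨F₁ (g.symm w), by rw [hG, g.apply_symm_apply]⟩

/-- An `A`-linear isomorphism `B ⊗_A B → B ⊗ H` descends to fibres. -/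
theorem exists_equiv_of_isFibreMap {S : Type*} [Ring S] [Algebra k S]
    {ι : A →ₐ[k] B} {s : A →ₐ[k] H} {χ : A →ₐ[k] k} {χS : S →ₐ[k] k}
    {p : B →ₐ[k] B'} {π : H →ₐ[k] H'}
    (hp : IsFibreMap ι χ p) (hπ : IsFibreMap s χ π)
    {ψ : Sᵐᵒᵖ →ₐ[k] Module.End k B} {φ : S →ₐ[k] Module.End k H}
    {ψ' : kᵐᵒᵖ →ₐ[k] Module.End k B'} {φ' : k →ₐ[k] Module.End k H'}
    (hf : RightEquivariant ψ ψ' χS p.toLinearMap) (hg : LeftEquivariant φ φ' χS π.toLinearMap)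
    (hιψ : ∀ a l b, ι a * ψ (op l) b = ψ (op l) (ι a * b))
    (hbal : ∀ a b h, Bal.mk ψ φ (b ⊗ₜ (s a * h)) = Bal.mk ψ φ ((ι a * b) ⊗ₜ h))
    (gal : Bal (rightMul (AlgHom.op ι)) (leftMul ι) ≃ₗ[k] Bal ψ φ)
    (hgal : ∀ a b b', ∃ u, gal (Bal.mk _ _ (b ⊗ₜ b')) = Bal.mk _ _ u ∧
      gal (Bal.mk _ _ ((ι a * b) ⊗ₜ b')) = Bal.mk _ _ ((ι a ⊗ₜ 1) * u))
    (hker₁ : ∀ b b', p b = 0 → Bal.map hf hg (gal (Bal.mk _ _ (b ⊗ₜ b'))) = 0)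
    (hker₂ : ∀ b b', p b' = 0 → Bal.map hf hg (gal (Bal.mk _ _ (b ⊗ₜ b'))) = 0) :
    ∃ gal' : Bal (rightMul (AlgHom.op (Algebra.ofId k B'))) (leftMul (Algebra.ofId k B')) ≃ₗ[k]
        Bal ψ' φ',
      ∀ b b', gal' (Bal.mk _ _ (p b ⊗ₜ p b')) =
        Bal.map hf hg (gal (Bal.mk _ _ (b ⊗ₜ b'))) := by
  have hr : RightEquivariant (rightMul (AlgHom.op ι)) (rightMul (AlgHom.op (Algebra.ofId k B')))
      χ p.toLinearMap :=
    rightEquivariant_of_smul _ fun a b => by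
      simp [rightMul, hp.unit, Algebra.smul_def, Algebra.commutes]
  have hl : LeftEquivariant (leftMul ι) (leftMul (Algebra.ofId k B')) χ p.toLinearMap :=
    leftEquivariant_of_smul _ fun a b => by
      simp [leftMul, hp.unit, Algebra.smul_def]
  -- By `hιψ`, left multiplication by `ι a` on the first factor is well defined on the balanced
  -- tensor product; `hgalT` below says that `gal` commutes with it.
  have hT : ∀ a, RightEquivariant ψ ψ (AlgHom.id k S) (LinearMap.mulLeft k (ι a)) :=
    fun a l b => hιψ a l b
  have hid : LeftEquivariant φ φ (AlgHom.id k S) LinearMap.id := fun _ _ => rfl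
  have hF₁ : Function.Surjective (Bal.map hr hl) := fun z => by
    obtain ⟨u, rfl⟩ := (balRel _ _).mkQ_surjective z
    obtain ⟨v, rfl⟩ := TensorProduct.map_surjective (g := p.toLinearMap) (g' := p.toLinearMap)
      hp.surjective hp.surjective u
    exact ⟨Bal.mk _ _ v, rfl⟩
  have hF₂ : Function.Surjective (Bal.map hf hg) := fun z => by
    obtain ⟨u, rfl⟩ := (balRel _ _).mkQ_surjective z
    obtain ⟨v, rfl⟩ := TensorProduct.map_surjective (g := p.toLinearMap) (g' := π.toLinearMap)
      hp.surjective hπ.surjective u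
    exact ⟨Bal.mk _ _ v, rfl⟩
  have hgalT : ∀ a v, gal (Bal.mk _ _ ((ι a ⊗ₜ 1) * v)) =
      Bal.map (hT a) hid (gal (Bal.mk _ _ v)) := by
    intro a v
    induction v with
    | zero => simp only [mul_zero, map_zero]
    | add x y hx hy => rw [mul_add, map_add, map_add, map_add, map_add, map_add, hx, hy]
    | tmul b b' =>
      obtain ⟨u, hu, hu'⟩ := hgal a b b'
      rw [Algebra.TensorProduct.tmul_mul_tmul, one_mul, hu', hu, Bal.map_mk, map_mulLeft_id]
  -- The inverse of `gal` commutes with `ι a` as well, so it carries `ι a * b ⊗ h` to a multiple of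
  -- `ι a`, which vanishes in the fibre when `χ a = 0`.
  have hback : ∀ a b h, χ a = 0 →
      Bal.map hr hl (gal.symm (Bal.mk ψ φ ((ι a * b) ⊗ₜ h))) = 0 := by
    intro a b h ha
    obtain ⟨v, hv⟩ := (balRel _ _).mkQ_surjective (gal.symm (Bal.mk ψ φ (b ⊗ₜ h)))
    have : gal.symm (Bal.mk ψ φ ((ι a * b) ⊗ₜ h)) = Bal.mk _ _ ((ι a ⊗ₜ 1) * v) := by
      rw [LinearEquiv.symm_apply_eq, hgalT]
      have hv' : gal (Bal.mk _ _ v) = Bal.mk ψ φ (b ⊗ₜ h) := by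
        rw [← LinearEquiv.eq_symm_apply]; exact hv
      rw [hv']
      rfl
    rw [this, Bal.map_mk, map_tensor_mul, TensorProduct.map_tmul, AlgHom.toLinearMap_apply,
      hp.unit, ha, map_zero, TensorProduct.zero_tmul, zero_mul, map_zero]
  have hker : ∀ v, Bal.map hr hl v = 0 → Bal.map hf hg (gal v) = 0 := by
    intro v hv
    obtain ⟨u, rfl⟩ := (balRel _ _).mkQ_surjective v
    exact eq_zero_of_map_eq_zero hp.surjective hp.surjective
      (Bal.map hf hg ∘ₗ gal.toLinearMap ∘ₗ Bal.mk _ _) hker₁ hker₂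
      (Bal.mk_injective _ _ (hv.trans (map_zero _).symm))
  have hker' : ∀ w, Bal.map hf hg w = 0 → Bal.map hr hl (gal.symm w) = 0 := by
    intro w hw
    obtain ⟨u, rfl⟩ := (balRel ψ φ).mkQ_surjective w
    refine eq_zero_of_map_eq_zero hp.surjective hπ.surjective
      (Bal.map hr hl ∘ₗ gal.symm.toLinearMap ∘ₗ Bal.mk ψ φ) ?_ ?_
      (Bal.mk_injective _ _ (hw.trans (map_zero _).symm))
    · intro b h hb
      exact hp.eq_zero (F := Bal.map hr hl ∘ₗ gal.symm.toLinearMap ∘ₗ Bal.mk ψ φ ∘ₗ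
        (TensorProduct.mk k B H).flip h) (fun a b ha => hback a b h ha) hb
    · intro b h hh
      refine hπ.eq_zero (F := Bal.map hr hl ∘ₗ gal.symm.toLinearMap ∘ₗ Bal.mk ψ φ ∘ₗ
        TensorProduct.mk k B H b) (fun a h ha => ?_) hh
      -- The kernel of `π` is spanned by the `s a * h`; `hbal` moves `s a` across the tensor sign
      -- and reduces to the first factor.
      refine (congrArg (fun z => Bal.map hr hl (gal.symm z)) (hbal a b h)).trans ?_
      exact hback a b h ha
  obtain ⟨gal', h'⟩ := exists_equiv_of_ker hF₁ hF₂ gal hker hker'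
  exact ⟨gal', fun b b' => h' (Bal.mk _ _ (b ⊗ₜ b'))⟩

/-- In a tensor square over a field, `1 ⊗ b = b ⊗ 1` only for scalars `b`. -/
theorem mem_range_ofId_of_one_tmul_eq {K E : Type*} [Field K] [Ring E] [Algebra K E]
    [Nontrivial E] {b : E} (h : (1 : E) ⊗ₜ[K] b = b ⊗ₜ[K] (1 : E)) :
    b ∈ Set.range (Algebra.ofId K E) := by
  -- A functional with `f 1 = 1`, applied to the first factor of `1 ⊗ b = b ⊗ 1`, gives `b = f b •
  -- 1`.
  obtain ⟨f, hf⟩ := Module.Projective.exists_dual_eq_one K (one_ne_zero (α := E))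
  have h' := congrArg (fun z => TensorProduct.lid K E (f.rTensor E z)) h
  exact ⟨f b, by simpa [hf, Algebra.ofId_apply, Algebra.algebraMap_eq_smul_one] using h'.symm⟩

end FibreMaps

/-! ### All base maps of a central covering agree; the structure maps descend. -/

section CentralCovering

variable {k : Type*} [CommRing k] {L A H B : Type*} [Ring L] [Algebra k L] [CommRing A]
  [Algebra k A] [Ring H] [Algebra k H] [Ring B] [Algebra k B]
  {𝓗 : HopfAlgebroid k L A H} {ι : A →ₐ[k] B} {ρ : ComoduleAlgebra 𝓗 ι}

theorem LeftBialgebroid.counit_source (𝓑 : LeftBialgebroid k L H) (l : L) :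
    𝓑.counit (𝓑.source l) = l := by
  have h := 𝓑.counit_bimodule l 1 1
  rwa [op_one, map_one, mul_one, mul_one, 𝓑.counit_one, mul_one, mul_one] at h

theorem RightBialgebroid.counit_target (𝓑 : RightBialgebroid k A H) (a : A) :
    𝓑.counit (𝓑.target (op a)) = a := by
  have h := 𝓑.counit_bimodule a 1 1
  rwa [map_one, mul_one, one_mul, 𝓑.counit_one, mul_one, mul_one] at h

/-- The homomorphism `ε_R ∘ s_L` of base algebras. -/
def HopfAlgebroid.baseHom (𝓗 : HopfAlgebroid k L A H) : L →ₐ[k] A :=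
  AlgHom.ofLinearMap (𝓗.right.counit ∘ₗ 𝓗.left.source.toLinearMap)
    (by simp [𝓗.right.counit_one]) fun l l' => by
      change 𝓗.right.counit (𝓗.left.source (l * l')) = _
      -- By `s_L = t_R ε_R s_L` the claim concerns `t_R`, which is anti-multiplicative with left
      -- inverse `ε_R`; commutativity of `A` repairs the order.
      rw [map_mul, ← 𝓗.tR_εR_sL l, ← 𝓗.tR_εR_sL l', ← map_mul, ← op_mul,
        𝓗.right.counit_target, mul_comm]
      rfl

theorem HopfAlgebroid.baseHom_apply (𝓗 : HopfAlgebroid k L A H) (l : L) :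
    𝓗.baseHom l = 𝓗.right.counit (𝓗.left.source l) :=
  rfl

/-- If `A ⊆ B`, then `1 ⊗ h` determines `h`. -/
theorem IsLocalCovering.one_tmul_injective (hcov : IsLocalCovering ρ) {h h' : H}
    (hh : Bal.mk (rightMul (AlgHom.op ι)) 𝓗.right.actL (1 ⊗ₜ h) = Bal.mk _ _ (1 ⊗ₜ h')) :
    h = h' := by
  let _ : Module A H := Module.compHom H 𝓗.right.actL.toRingHom
  have : Module.Projective A H := hcov.fgProjective_right_actL.2
  have : IsScalarTower k A H := ⟨fun c a h => by
    change 𝓗.right.actL (c • a) h = c • 𝓗.right.actL a h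
    rw [map_smul, LinearMap.smul_apply]⟩
  -- Projectivity makes `A`-linear functionals `f` separate points of `H`. The map `b ⊗ h ↦ b ι(f
  -- h)` respects the balancing and sends `1 ⊗ h` to `ι(f h)`, which determines `f h`.
  rw [← sub_eq_zero, ← Module.forall_dual_apply_eq_zero_iff A]
  intro f
  have hΦ : balRel (rightMul (AlgHom.op ι)) 𝓗.right.actL ≤ LinearMap.ker
      (LinearMap.mul' k B ∘ₗ (ι.toLinearMap ∘ₗ f.restrictScalars k).lTensor B) := by
    rw [balRel, Submodule.span_le]
    rintro _ ⟨a, b, h, rfl⟩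
    have hf : f (𝓗.right.actL a h) = a * f h := f.map_smul a h
    rw [SetLike.mem_coe, LinearMap.mem_ker, map_sub, sub_eq_zero]
    simp only [LinearMap.comp_apply, LinearMap.lTensor_tmul, LinearMap.mul'_apply,
      LinearMap.restrictScalars_apply, AlgHom.toLinearMap_apply, hf, map_mul]
    exact mul_assoc b (ι a) _
  have hz : (1 : B) ⊗ₜ[k] (h - h') ∈ balRel (rightMul (AlgHom.op ι)) 𝓗.right.actL := by
    rw [TensorProduct.tmul_sub]
    exact (Submodule.Quotient.eq _).1 hh
  have := hΦ hz
  apply hcov.injective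
  simpa using this

/-- Source and target map of the right bialgebroid of a local covering agree. -/
theorem IsLocalCovering.source_eq_target (hcov : IsLocalCovering ρ) (a : A) :
    𝓗.right.source a = 𝓗.right.target (op a) := by
  apply hcov.one_tmul_injective
  -- Two values of `ρ_R(ι a)`: linearity gives `1 ⊗ s_R(a)`, and coinvariance gives `ι a ⊗ 1`, which
  -- is `1 ⊗ t_R(a)` by balancing.
  have h₁ := ρ.coactR_R 1 a (1 ⊗ₜ 1) ρ.coactR_one.symm
  have h₂ : ρ.coactR (ι a) = Bal.mk _ _ (ι a ⊗ₜ 1) := by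
    have : ι a ∈ Set.range ι := ⟨a, rfl⟩
    rwa [← hcov.coinvariants_R] at this
  rw [one_mul, h₂, Algebra.TensorProduct.tmul_mul_tmul, one_mul, one_mul] at h₁
  rw [← h₁]
  have h₃ := Bal.mk_smul_tmul (ψ := rightMul (AlgHom.op ι)) (φ := 𝓗.right.actL) a 1 1
  simpa [rightMul, AlgHom.opComm] using h₃

variable (hcov : IsLocalCovering ρ) (hcentral : IsCentralIn 𝓗 ι)

include hcentral in
theorem IsCentralIn.inclusion_comm (a : A) (b : B) : ι a * b = b * ι a :=
  (hcentral.inclusion a).comm b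

include hcentral in
theorem IsCentralIn.source_comm (a : A) (h : H) :
    𝓗.right.source a * h = h * 𝓗.right.source a :=
  (hcentral.source a).comm h

include hcov

theorem IsLocalCovering.left_source (l : L) :
    𝓗.left.source l = 𝓗.right.source (𝓗.baseHom l) := by
  rw [hcov.source_eq_target, 𝓗.baseHom_apply, 𝓗.tR_εR_sL]

/-- Since `l = ε_L(s_L(l)) = ε_L(s_R(θ l))` with `θ` the map `baseHom`, the axiom `t_L ε_L s_R =
s_R` applies. -/
theorem IsLocalCovering.left_target (l : L) :
    𝓗.left.target (op l) = 𝓗.right.source (𝓗.baseHom l) := by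
  conv_lhs => rw [← 𝓗.left.counit_source l, hcov.left_source, 𝓗.tL_εL_sR]

/-- Together with `left_source_counit`, this makes `ε_L(s_R(a))` the element of `L` that corresponds
to `a`; it is the witness whenever an axiom over `L` is used for `A`. -/
theorem IsLocalCovering.baseHom_counit_source (a : A) :
    𝓗.baseHom (𝓗.left.counit (𝓗.right.source a)) = a := by
  rw [𝓗.baseHom_apply, hcov.source_eq_target, 𝓗.sL_εL_tR, 𝓗.right.counit_target]

theorem IsLocalCovering.left_source_counit (a : A) :
    𝓗.left.source (𝓗.left.counit (𝓗.right.source a)) = 𝓗.right.source a := by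
  rw [hcov.left_source, hcov.baseHom_counit_source]

include hcentral

/-- The coaction `ρ_R` is injective by its counit law, and it takes the same value on both sides
because `t_L(l)` is a central element of the form `s_R(a)`. -/
theorem IsLocalCovering.actL_apply (l : L) (b : B) :
    ρ.actL (op l) b = b * ι (𝓗.baseHom l) := by
  obtain ⟨u, hu⟩ := (balRel _ _).mkQ_surjective (ρ.coactR b)
  have h : ρ.coactR (ρ.actL (op l) b) = ρ.coactR (b * ι (𝓗.baseHom l)) := by
    rw [ρ.coactR_L b l u hu, ρ.coactR_R b _ u hu, hcov.left_target,
      one_tmul_mul_comm (hcentral.source_comm _)]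
  obtain ⟨v, hv⟩ := (balRel _ _).mkQ_surjective (ρ.coactR (ρ.actL (op l) b))
  rw [← ρ.counit_R _ v hv, ← ρ.counit_R _ v (hv.trans h)]

variable {H' B' : Type*} [Ring H'] [Algebra k H'] [Ring B'] [Algebra k B'] {χ : A →ₐ[k] k}
  {π : H →ₐ[k] H'} {p : B →ₐ[k] B'} (hπ : IsFibreMap 𝓗.right.source χ π)

include hπ

omit hcentral in
theorem IsLocalCovering.left_descends : 𝓗.left.Descends (χ.comp 𝓗.baseHom) π := by
  have hs : ∀ l, π (𝓗.left.source l) = algebraMap k H' (χ.comp 𝓗.baseHom l) := fun l => by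
    rw [hcov.left_source, hπ.unit, AlgHom.comp_apply]
  have ht : ∀ l, π (𝓗.left.target (op l)) = algebraMap k H' (χ.comp 𝓗.baseHom l) := fun l => by
    rw [hcov.left_target, hπ.unit, AlgHom.comp_apply]
  refine ⟨hπ.surjective, hs, ht, fun h hh => ?_, fun h u hh hu => ?_⟩
  · refine hπ.eq_zero (F := (χ.comp 𝓗.baseHom).toLinearMap ∘ₗ 𝓗.left.counit) (fun a h ha => ?_) hh
    have h₁ := 𝓗.left.counit_bimodule (𝓗.left.counit (𝓗.right.source a)) 1 h
    rw [op_one, map_one, mul_one, mul_one, hcov.left_source_counit] at h₁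
    simp [h₁, hcov.baseHom_counit_source, ha]
  · have hR : RightEquivariant 𝓗.left.actR (leftMul (opScalar k H')) (χ.comp 𝓗.baseHom)
        π.toLinearMap := rightEquivariant_of_smul _ fun l h => by
      simp only [leftMul, AlgHom.comp_apply, Algebra.coe_lmul_eq_mul, LinearMap.mul_apply_apply,
        AlgHom.toLinearMap_apply, map_mul, ht, Algebra.smul_def]
    have hL : LeftEquivariant 𝓗.left.actL (leftMul (Algebra.ofId k H')) (χ.comp 𝓗.baseHom)
        π.toLinearMap := leftEquivariant_of_smul _ fun l h => by
      simp only [leftMul, AlgHom.comp_apply, Algebra.coe_lmul_eq_mul, LinearMap.mul_apply_apply,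
        AlgHom.toLinearMap_apply, map_mul, hs, Algebra.smul_def]
    -- A representative does not depend linearly on `h`, but its class does. Passing to the class
    -- gives a linear map of `h`, to which `IsFibreMap.eq_zero` applies.
    refine Bal.mk_injective (leftMul (opScalar k H')) (leftMul (Algebra.ofId k H')) ?_
    rw [map_zero, ← Bal.map_mk hR hL, hu]
    refine hπ.eq_zero (F := Bal.map hR hL ∘ₗ 𝓗.left.comul) (fun a h ha => ?_) hh
    obtain ⟨v, hv⟩ := (balRel _ _).mkQ_surjective (𝓗.left.comul h)
    have h₁ := 𝓗.left.comul_bimodule (𝓗.left.counit (𝓗.right.source a)) 1 h v hv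
    rw [op_one, map_one, mul_one, hcov.left_source_counit] at h₁
    rw [LinearMap.comp_apply, h₁, Bal.map_mk, map_tensor_mul, TensorProduct.map_tmul,
      AlgHom.toLinearMap_apply, hπ.unit, ha, map_zero, TensorProduct.zero_tmul, zero_mul, map_zero]

theorem IsLocalCovering.right_descends : 𝓗.right.Descends χ π := by
  have ht : ∀ a, π (𝓗.right.target (op a)) = algebraMap k H' (χ a) := fun a => by
    rw [← hcov.source_eq_target, hπ.unit]
  refine ⟨hπ.surjective, hπ.unit, ht, fun h hh => ?_, fun h u hh hu => ?_⟩
  · refine hπ.eq_zero (F := χ.toLinearMap ∘ₗ 𝓗.right.counit) (fun a h ha => ?_) hh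
    have h₁ := 𝓗.right.counit_bimodule 1 a h
    -- The right bialgebroid is linear for right multiplication by `s_R(a)`; centrality turns this
    -- into the left multiplication that generates `ker π`.
    rw [op_one, map_one, mul_one, one_mul, ← hcentral.source_comm] at h₁
    simp [h₁, ha]
  · have hR : RightEquivariant 𝓗.right.actR (rightMul (AlgHom.op (Algebra.ofId k H'))) χ
        π.toLinearMap := rightEquivariant_of_smul _ fun l h => by
      simp [rightMul, hπ.unit, Algebra.smul_def, Algebra.commutes]
    have hL : LeftEquivariant 𝓗.right.actL (rightMul (AlgHom.opComm.symm (opScalar k H'))) χ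
        π.toLinearMap := leftEquivariant_of_smul _ fun l h => by
      simp [rightMul, AlgHom.opComm, ht, Algebra.smul_def, Algebra.commutes]
    refine Bal.mk_injective (rightMul (AlgHom.op (Algebra.ofId k H')))
      (rightMul (AlgHom.opComm.symm (opScalar k H'))) ?_
    rw [map_zero, ← Bal.map_mk hR hL, hu]
    refine hπ.eq_zero (F := Bal.map hR hL ∘ₗ 𝓗.right.comul) (fun a h ha => ?_) hh
    obtain ⟨v, hv⟩ := (balRel _ _).mkQ_surjective (𝓗.right.comul h)
    have h₁ := 𝓗.right.comul_bimodule 1 a h v hv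
    rw [op_one, map_one, mul_one, ← hcentral.source_comm] at h₁
    rw [LinearMap.comp_apply, h₁, Bal.map_mk, map_tensor_mul, TensorProduct.map_tmul,
      AlgHom.toLinearMap_apply, AlgHom.toLinearMap_apply, hπ.unit, ha, map_zero,
      TensorProduct.tmul_zero, mul_zero, map_zero]

omit hcentral hπ in
theorem IsLocalCovering.antipode_source_mul (a : A) (h : H) :
    𝓗.antipode (𝓗.right.source a * h) = 𝓗.antipode h * 𝓗.right.source a := by
  have h₁ := 𝓗.antipode_mul (𝓗.left.counit (𝓗.right.source a)) 1 h
  rwa [op_one, map_one, mul_one, 𝓗.tL_εL_sR, hcov.left_source_counit, map_one, one_mul] at h₁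

theorem IsLocalCovering.descends : 𝓗.Descends (χ.comp 𝓗.baseHom) χ π where
  left := hcov.left_descends hπ
  right := hcov.right_descends hcentral hπ
  antipode h hh := hπ.eq_zero (F := π.toLinearMap ∘ₗ 𝓗.antipode) (fun a h ha => by
    simp [hcov.antipode_source_mul, hπ.unit, ha]) hh

/-- By centrality the inverse antipode commutes with multiplication by `s_R(a)`, so it preserves
`ker π`. -/
theorem IsLocalCovering.antipode_reflects {h : H} (hh : π (𝓗.antipode h) = 0) : π h = 0 := by
  let e := LinearEquiv.ofBijective 𝓗.antipode hcov.antipode_bijective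
  have key : (π.toLinearMap ∘ₗ e.symm.toLinearMap) (𝓗.antipode h) = 0 := by
    refine hπ.eq_zero (fun a g ha => ?_) hh
    have : e.symm (𝓗.right.source a * g) = 𝓗.right.source a * e.symm g := by
      rw [LinearEquiv.symm_apply_eq]
      change _ = 𝓗.antipode _
      rw [hcov.antipode_source_mul, hcentral.source_comm]
      exact congrArg (· * _) (e.apply_symm_apply g).symm
    simp only [LinearMap.comp_apply, LinearEquiv.coe_coe, this]
    exact hπ.map_mul_eq_zero ha _
  have : e.symm (𝓗.antipode h) = h := e.symm_apply_apply h
  simpa [this] using key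

variable (hp : IsFibreMap ι χ p)
include hp

theorem IsLocalCovering.comodule_descends : ρ.Descends (χ.comp 𝓗.baseHom) χ π p := by
  have hact : ∀ l b, p (ρ.actL (op l) b) = χ.comp 𝓗.baseHom l • p b := fun l b => by
    rw [hcov.actL_apply hcentral, map_mul, hp.unit, ← Algebra.commutes, ← Algebra.smul_def,
      AlgHom.comp_apply]
  -- Both coactions are linear for right multiplication by `ι a`, which appears as `s_R(a)` in the
  -- second leg; this factor is killed by `π` when `χ a = 0`.
  have hz : ∀ (a : A) (v : B ⊗[k] H), χ a = 0 → TensorProduct.map p.toLinearMap π.toLinearMap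
      (v * (1 ⊗ₜ 𝓗.right.source a)) = 0 := fun a v ha => by
    rw [map_tensor_mul, TensorProduct.map_tmul, AlgHom.toLinearMap_apply,
      AlgHom.toLinearMap_apply, hπ.unit, ha, map_zero, TensorProduct.tmul_zero, mul_zero]
  refine ⟨hp.surjective, hp.unit, hact, fun b u hb hu => ?_, fun b u hb hu => ?_⟩
  · have hR : RightEquivariant (rightMul (AlgHom.op ι))
        (rightMul (AlgHom.op (Algebra.ofId k B'))) χ p.toLinearMap :=
      rightEquivariant_of_smul _ fun l h => by
        simp [rightMul, hp.unit, Algebra.smul_def, Algebra.commutes]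
    have hL := (hcov.right_descends hcentral hπ).actL
    refine Bal.mk_injective (rightMul (AlgHom.op (Algebra.ofId k B')))
      (rightMul (AlgHom.opComm.symm (opScalar k H'))) ?_
    rw [map_zero, ← Bal.map_mk hR hL, hu]
    refine hp.eq_zero (F := Bal.map hR hL ∘ₗ ρ.coactR) (fun a b ha => ?_) hb
    obtain ⟨v, hv⟩ := (balRel _ _).mkQ_surjective (ρ.coactR b)
    rw [LinearMap.comp_apply, hcentral.inclusion_comm, ρ.coactR_R b a v hv, Bal.map_mk,
      hz a v ha, map_zero]
  · have hR : RightEquivariant ρ.actL (opScalar k (Module.End k B')) (χ.comp 𝓗.baseHom)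
        p.toLinearMap := rightEquivariant_of_smul _ hact
    have hL := (hcov.left_descends hπ).actL
    refine Bal.mk_injective (opScalar k (Module.End k B')) (leftMul (Algebra.ofId k H')) ?_
    rw [map_zero, ← Bal.map_mk hR hL, hu]
    refine hp.eq_zero (F := Bal.map hR hL ∘ₗ ρ.coactL) (fun a b ha => ?_) hb
    obtain ⟨v, hv⟩ := (balRel _ _).mkQ_surjective (ρ.coactL b)
    rw [LinearMap.comp_apply, hcentral.inclusion_comm, ρ.coactL_R b a v hv, Bal.map_mk,
      hz a v ha, map_zero]

end CentralCovering

/-! ### Galois maps, finiteness and nontriviality of the fibre. -/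

section CentralGalois

variable {k : Type*} [CommRing k] {L A H B : Type*} [Ring L] [Algebra k L] [CommRing A]
  [Algebra k A] [Ring H] [Algebra k H] [Ring B] [Algebra k B]
  {𝓗 : HopfAlgebroid k L A H} {ι : A →ₐ[k] B} {ρ : ComoduleAlgebra 𝓗 ι}
  {H' B' : Type*} [Ring H'] [Algebra k H'] [Ring B'] [Algebra k B'] {χ : A →ₐ[k] k}
  {π : H →ₐ[k] H'} {p : B →ₐ[k] B'}

/-- This Galois map is left `B`-linear, hence commutes with `ι a` in the first factor. -/
theorem IsLocalCovering.galois_R_descends (hcov : IsLocalCovering ρ) (hcentral : IsCentralIn 𝓗 ι)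
    (hπ : IsFibreMap 𝓗.right.source χ π) (hp : IsFibreMap ι χ p)
    {χL : L →ₐ[k] k} (hρ : ρ.Descends χL χ π p) (h𝓗 : 𝓗.Descends χL χ π) :
    GaloisMapRBijective (hρ.fibre h𝓗) := by
  obtain ⟨gal, hgal⟩ := hcov.galois_R
  have hmap : ∀ b (u : B ⊗[k] H), Bal.map hρ.equivariantR h𝓗.right.actL
      (Bal.mk _ _ ((b ⊗ₜ 1) * u)) = Bal.mk _ _ ((p b ⊗ₜ 1) *
        TensorProduct.map p.toLinearMap π.toLinearMap u) := fun b u => by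
    rw [Bal.map_mk, map_tensor_mul, TensorProduct.map_tmul, AlgHom.toLinearMap_apply,
      AlgHom.toLinearMap_apply, map_one]
  obtain ⟨gal', hgal'⟩ := exists_equiv_of_isFibreMap hp hπ hρ.equivariantR h𝓗.right.actL
    (fun a l b => (mul_assoc (ι a) b (ι l)).symm)
    (fun a b h => by
      rw [hcentral.source_comm, hcentral.inclusion_comm, hcov.source_eq_target]
      exact (Bal.mk_smul_tmul (ψ := rightMul (AlgHom.op ι)) (φ := 𝓗.right.actL) a b h).symm)
    gal
    (fun a b b' => by
      obtain ⟨u, hu⟩ := (balRel _ _).mkQ_surjective (ρ.coactR b')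
      refine ⟨(b ⊗ₜ 1) * u, hgal b b' u hu, ?_⟩
      rw [hgal (ι a * b) b' u hu, ← mul_assoc, Algebra.TensorProduct.tmul_mul_tmul, one_mul])
    (fun b b' hb => by
      obtain ⟨u, hu⟩ := (balRel _ _).mkQ_surjective (ρ.coactR b')
      rw [hgal b b' u hu, hmap, hb, TensorProduct.zero_tmul, zero_mul, map_zero])
    (fun b b' hb => by
      obtain ⟨u, hu⟩ := (balRel _ _).mkQ_surjective (ρ.coactR b')
      rw [hgal b b' u hu, hmap, hρ.coactR b' u hb hu, mul_zero, map_zero])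
  refine ⟨gal', fun a' b' u' hu' => ?_⟩
  obtain ⟨a, rfl⟩ := hp.surjective a'
  obtain ⟨b, rfl⟩ := hp.surjective b'
  obtain ⟨u, hu, rfl⟩ := hρ.exists_repR h𝓗 hu'
  exact (hgal' a b).trans ((congrArg _ (hgal a b u hu)).trans (hmap a u))

theorem IsLocalCovering.galois_L_descends (hcov : IsLocalCovering ρ) (hcentral : IsCentralIn 𝓗 ι)
    (hπ : IsFibreMap 𝓗.right.source χ π) (hp : IsFibreMap ι χ p)
    {χL : L →ₐ[k] k} (hρ : ρ.Descends χL χ π p) (h𝓗 : 𝓗.Descends χL χ π) :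
    GaloisMapLBijective (hρ.fibre h𝓗) := by
  obtain ⟨gal, hgal⟩ := hcov.galois_L
  have hmap : ∀ b (u : B ⊗[k] H), Bal.map hρ.equivariantL h𝓗.left.actL
      (Bal.mk _ _ (u * (b ⊗ₜ 1))) = Bal.mk _ _ (TensorProduct.map p.toLinearMap π.toLinearMap u *
        (p b ⊗ₜ 1)) := fun b u => by
    rw [Bal.map_mk, map_tensor_mul, TensorProduct.map_tmul, AlgHom.toLinearMap_apply,
      AlgHom.toLinearMap_apply, map_one]
  obtain ⟨gal', hgal'⟩ := exists_equiv_of_isFibreMap hp hπ hρ.equivariantL h𝓗.left.actL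
    (fun a l b => by
      rw [hcov.actL_apply hcentral, hcov.actL_apply hcentral, mul_assoc])
    (fun a b h => by
      -- Balancing over `L` at `ε_L(s_R(a))`, which acts on `B` as `ι a` and on `H` as `s_R(a)`.
      have h₁ := Bal.mk_smul_tmul (ψ := ρ.actL) (φ := 𝓗.left.actL)
        (𝓗.left.counit (𝓗.right.source a)) b h
      rw [hcov.actL_apply hcentral, hcov.baseHom_counit_source, ← hcentral.inclusion_comm] at h₁
      rw [h₁, ← hcov.left_source_counit a]
      simp only [hcov.left_source_counit]
      exact congrArg (fun z => Bal.mk _ _ (b ⊗ₜ (z * h))) (hcov.left_source_counit a).symm)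
    gal
    (fun a b b' => by
      obtain ⟨u, hu⟩ := (balRel _ _).mkQ_surjective (ρ.coactL b)
      refine ⟨u * (b' ⊗ₜ 1), hgal b b' u hu, ?_⟩
      -- The second Galois map is linear in its right factor instead: `ι a` is moved there by
      -- balancing, passes through `ρ_L`'s legs as `ι a ⊗ 1`, and returns to the left by centrality.
      have h₁ := Bal.mk_smul_tmul (ψ := rightMul (AlgHom.op ι)) (φ := leftMul ι) a b b'
      have h₂ : Bal.mk (rightMul (AlgHom.op ι)) (leftMul ι) ((ι a * b) ⊗ₜ b') =
          Bal.mk _ _ (b ⊗ₜ (ι a * b')) := by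
        rw [hcentral.inclusion_comm a b]
        exact h₁
      rw [h₂, hgal b (ι a * b') u hu, ← mul_assoc, tmul_one_mul_comm (hcentral.inclusion_comm a),
        mul_assoc, Algebra.TensorProduct.tmul_mul_tmul, one_mul])
    (fun b b' hb => by
      obtain ⟨u, hu⟩ := (balRel _ _).mkQ_surjective (ρ.coactL b)
      rw [hgal b b' u hu, hmap, hρ.coactL b u hb hu, zero_mul, map_zero])
    (fun b b' hb => by
      obtain ⟨u, hu⟩ := (balRel _ _).mkQ_surjective (ρ.coactL b)
      rw [hgal b b' u hu, hmap, hb, TensorProduct.zero_tmul, mul_zero, map_zero])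
  refine ⟨gal', fun a' b' u' hu' => ?_⟩
  obtain ⟨a, rfl⟩ := hp.surjective a'
  obtain ⟨b, rfl⟩ := hp.surjective b'
  obtain ⟨u, hu, rfl⟩ := hρ.exists_repL h𝓗 hu'
  exact (hgal' a b).trans ((congrArg _ (hgal a b u hu)).trans (hmap b u))

/-- The projection is a surjection semilinear over `χ`, so images of `A`-generators span over `k`.
-/
theorem IsFibreMap.finite {ι : A →ₐ[k] B} (hp : IsFibreMap ι χ p)
    (hfg : IsFGProjective (leftMul ι)) : Module.Finite k B' := by
  let _ : Module A B := Module.compHom B (leftMul ι).toRingHom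
  have : Module.Finite A B := hfg.1
  have hsurj : Function.Surjective (χ : A →+* k) := fun c => ⟨algebraMap k A c, χ.commutes c⟩
  have : RingHomSurjective (χ : A →+* k) := ⟨hsurj⟩
  let f : B →ₛₗ[(χ : A →+* k)] B' :=
    { toFun := p
      map_add' := map_add p
      map_smul' := fun a b => by
        change p (ι a * b) = χ a • p b
        rw [map_mul, hp.unit, Algebra.smul_def] }
  exact Module.Finite.of_surjective f hp.surjective

/-- Nakayama: if the fibre vanished, then `B = I B` for `I = ker χ`, so some `a` with `a - 1 ∈ I`
would annihilate `B`. Then `ι a = 0`, hence `a = 0`, contradicting `χ a = 1`. -/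
theorem IsFibreMap.nontrivial [Nontrivial k] {ι : A →ₐ[k] B} (hp : IsFibreMap ι χ p)
    (hι : Function.Injective ι) (hfg : IsFGProjective (leftMul ι)) : Nontrivial B' := by
  let _ : Module A B := Module.compHom B (leftMul ι).toRingHom
  have : Module.Finite A B := hfg.1
  by_contra hB'
  rw [not_nontrivial_iff_subsingleton] at hB'
  let I : Ideal A := RingHom.ker (χ : A →+* k)
  let N : Submodule A B := I • ⊤
  have hN : ∀ b, b ∈ N := fun b => by
    refine Submodule.span_induction (p := fun b _ => b ∈ N) ?_ (zero_mem N)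
      (fun _ _ _ _ => add_mem) (fun c z _ hz => ?_) (hp.ker b (Subsingleton.elim _ _))
    · rintro _ ⟨a, b', ha, rfl⟩
      have haI : a ∈ I := ha
      exact Submodule.smul_mem_smul haI (Submodule.mem_top (x := b'))
    · have hc : c • z = ι (algebraMap k A c) * z := by rw [AlgHom.commutes, Algebra.smul_def]
      rw [hc]
      exact N.smul_mem (algebraMap k A c) hz
  obtain ⟨a, ha, hab⟩ := Submodule.exists_sub_one_mem_and_smul_eq_zero_of_fg_of_le_smul
    I (⊤ : Submodule A B) Module.Finite.fg_top fun b _ => hN b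
  have ha₀ : a = 0 := hι (by
    rw [map_zero, ← mul_one (ι a)]
    exact hab 1 Submodule.mem_top)
  have ha' : χ (a - 1) = 0 := ha
  rw [ha₀, zero_sub, map_neg, map_one, neg_eq_zero] at ha'
  exact one_ne_zero ha'

end CentralGalois

/-! ### Coverings of a point over a field. -/

section Point

variable {K L H E : Type*} [Field K] [Ring L] [Algebra K L] [Ring H] [Algebra K H]
  [Ring E] [Algebra K E]

theorem isFGProjective_of_finite {D V : Type*} [DivisionRing D] [Algebra K D] [AddCommGroup V]
    [Module K V] [Module.Finite K V] (φ : D →ₐ[K] Module.End K V) : IsFGProjective φ := by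
  let _ : Module D V := Module.compHom V φ.toRingHom
  have : IsScalarTower K D V := ⟨fun c d v => by
    change φ (c • d) v = c • φ d v
    rw [map_smul, LinearMap.smul_apply]⟩
  exact ⟨Module.Finite.of_restrictScalars_finite K D V, Module.Projective.of_free⟩

/-- For coinvariant `b`, the Galois map sends both `1 ⊗ b` and `b ⊗ 1` to `b ⊗ 1`; injectivity makes
the two tensors equal, so `b` is a scalar. -/
theorem coinvariants_R_of_galois [Nontrivial E] {𝓗 : HopfAlgebroid K L K H}
    {ρ : ComoduleAlgebra 𝓗 (Algebra.ofId K E)} (hρ : GaloisMapRBijective ρ) :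
    {b | ρ.coactR b = Bal.mk _ _ (b ⊗ₜ 1)} = Set.range (Algebra.ofId K E) := by
  obtain ⟨gal, hgal⟩ := hρ
  ext b
  constructor
  · intro hb
    refine mem_range_ofId_of_one_tmul_eq (Bal.mk_injective (rightMul (AlgHom.op (Algebra.ofId K E)))
      (leftMul (Algebra.ofId K E)) (gal.injective ?_))
    rw [hgal 1 b _ hb.symm, hgal b 1 _ ρ.coactR_one.symm, ← Algebra.TensorProduct.one_def, one_mul,
      mul_one]
  · rintro ⟨c, rfl⟩
    rw [Set.mem_ofPred_eq, Algebra.ofId_apply, Algebra.algebraMap_eq_smul_one, map_smul,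
      ρ.coactR_one, ← map_smul]
    rfl

theorem coinvariants_L_of_galois [Nontrivial E] {𝓗 : HopfAlgebroid K L K H}
    {ρ : ComoduleAlgebra 𝓗 (Algebra.ofId K E)} (hρ : GaloisMapLBijective ρ) :
    {b | ρ.coactL b = Bal.mk _ _ (b ⊗ₜ 1)} = Set.range (Algebra.ofId K E) := by
  obtain ⟨gal, hgal⟩ := hρ
  ext b
  constructor
  · intro hb
    refine mem_range_ofId_of_one_tmul_eq (Bal.mk_injective (rightMul (AlgHom.op (Algebra.ofId K E)))
      (leftMul (Algebra.ofId K E)) (gal.injective ?_))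
    rw [hgal b 1 _ hb.symm, hgal 1 b _ ρ.coactL_one.symm, ← Algebra.TensorProduct.one_def, one_mul,
      mul_one]
  · rintro ⟨c, rfl⟩
    rw [Set.mem_ofPred_eq, Algebra.ofId_apply, Algebra.algebraMap_eq_smul_one, map_smul,
      ρ.coactL_one, ← map_smul]
    rfl

/-- The fibre of a central local covering at a character of the base is a covering of the point. -/
theorem IsLocalCovering.fibre {A B H' : Type*} {B' : Type*} [CommRing A] [Algebra K A] [Ring B]
    [Algebra K B] [Ring H'] [Algebra K H'] [Ring B'] [Algebra K B'] {𝓗 : HopfAlgebroid K L A H}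
    {ι : A →ₐ[K] B} {ρ : ComoduleAlgebra 𝓗 ι} (hcov : IsLocalCovering ρ)
    (hcentral : IsCentralIn 𝓗 ι) {χ : A →ₐ[K] K} {π : H →ₐ[K] H'} {p : B →ₐ[K] B'}
    (hπ : IsFibreMap 𝓗.right.source χ π) (hp : IsFibreMap ι χ p) {χL : L →ₐ[K] K}
    (hρ : ρ.Descends χL χ π p) (h𝓗 : 𝓗.Descends χL χ π) : IsLocalCovering (hρ.fibre h𝓗) := by
  have hB' : Nontrivial B' := hp.nontrivial hcov.injective hcov.fgProjective
  -- Finiteness is given for the action `h t_R(a)`, whereas the fibre is taken for `s_R(a) h`; these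
  -- coincide.
  have hact : leftMul 𝓗.right.source = 𝓗.right.actL := by
    ext a h
    change 𝓗.right.source a * h = h * 𝓗.right.target (op a)
    rw [hcentral.source_comm, hcov.source_eq_target]
  have : Module.Finite K H' := hπ.finite (hact ▸ hcov.fgProjective_right_actL)
  have : Module.Finite K B' := hp.finite hcov.fgProjective
  have hR := hcov.galois_R_descends hcentral hπ hp hρ h𝓗
  have hL := hcov.galois_L_descends hcentral hπ hp hρ h𝓗
  exact {
    injective := (algebraMap K B').injective
    antipode_bijective := by
      constructor
      · refine (injective_iff_map_eq_zero h𝓗.fibreAntipode).2 fun h' hh' => ?_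
        obtain ⟨h, rfl⟩ := hπ.surjective h'
        rw [h𝓗.fibreAntipode_apply] at hh'
        exact hcov.antipode_reflects hcentral hπ hh'
      · intro h'
        obtain ⟨g, rfl⟩ := hπ.surjective h'
        obtain ⟨h, rfl⟩ := hcov.antipode_bijective.2 g
        exact ⟨π h, h𝓗.fibreAntipode_apply h⟩
    fgProjective_right_actL := isFGProjective_of_finite _
    fgProjective_right_actR := isFGProjective_of_finite _
    fgProjective_left_actL := isFGProjective_of_finite _
    fgProjective_left_actR := isFGProjective_of_finite _
    fgProjective := isFGProjective_of_finite _
    coinvariants_R := coinvariants_R_of_galois hR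
    coinvariants_L := coinvariants_L_of_galois hL
    galois_R := hR
    galois_L := hL }

end Point

/-! ### The fibre at a point of `X` as a fibre at the evaluation character. -/

section FibreOverPoint

variable {X B : Type*} [TopologicalSpace X] [Ring B] [Algebra ℂ B]

/-- Because `ι a` is central, the span of the one-sided products is already stable under
multiplication on both sides. -/
theorem mem_span_of_mem_fibreIdeal {ι : C(X, ℂ) →ₐ[ℂ] B} (hι : ∀ a b, ι a * b = b * ι a) (x : X)
    {b : B} (hb : b ∈ fibreIdeal ι x) : b ∈ Submodule.span ℂ
      {z | ∃ a b', ContinuousMap.evalAlgHom ℂ ℂ x a = 0 ∧ z = ι a * b'} := by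
  set J := Submodule.span ℂ {z | ∃ a b', ContinuousMap.evalAlgHom ℂ ℂ x a = 0 ∧ z = ι a * b'}
  have hl : ∀ c, J ≤ J.comap (LinearMap.mulLeft ℂ c) := fun c => by
    rw [Submodule.span_le]
    rintro _ ⟨a, b', ha, rfl⟩
    refine Submodule.subset_span ⟨a, c * b', ha, ?_⟩
    rw [LinearMap.mulLeft_apply, ← mul_assoc, ← hι, mul_assoc]
  have hr : ∀ c, J ≤ J.comap (LinearMap.mulRight ℂ c) := fun c => by
    rw [Submodule.span_le]
    rintro _ ⟨a, b', ha, rfl⟩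
    exact Submodule.subset_span ⟨a, b' * c, ha, mul_assoc _ _ _⟩
  refine TwoSidedIdeal.span_induction (p := fun b _ => b ∈ J) ?_ (zero_mem J)
    (fun _ _ _ _ => add_mem) (fun _ _ => neg_mem) (fun c _ _ hz => hl c hz)
    (fun c _ _ hz => hr c hz) hb
  rintro _ ⟨a, ha, rfl⟩
  exact Submodule.subset_span ⟨a, 1, ha, (mul_one _).symm⟩

theorem isFibreMap_toFibre {ι : C(X, ℂ) →ₐ[ℂ] B} (hι : ∀ a b, ι a * b = b * ι a) (x : X) :
    IsFibreMap ι (ContinuousMap.evalAlgHom ℂ ℂ x) (toFibre ι x) where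
  surjective := (fibreIdeal ι x).ringCon.mk'_surjective
  unit a := by
    rw [← sub_eq_zero, ← AlgHom.commutes (toFibre ι x), ← AlgHom.commutes ι, ← map_sub, ← map_sub]
    -- The function `a - a x` vanishes at `x`, so its image lies in the ideal.
    refine (RingCon.eq _).2 (TwoSidedIdeal.subset_span ⟨_, ?_, rfl⟩)
    change a x - a x = 0
    exact sub_self _
  ker b hb := mem_span_of_mem_fibreIdeal hι x ((RingCon.eq _).1 hb)

end FibreOverPoint

end NCCovering

end

open scoped TensorProduct in
open MulOpposite NCCovering in
/-- For a central local covering `(B, 𝓗)` of `C(X)` and a point `x`: the structure maps of `𝓗` and the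
coactions on `B` descend to the fibres (they are determined there, the projections being surjective),
and the fibres form a covering of the point. The base algebra `L` of the left bialgebroid is
identified with `C(X)` through `ε_R ∘ s_L`, so that `x` becomes the character `χ` of `L`. -/
theorem theorem5 {X : Type*} [TopologicalSpace X] [CompactSpace X] [T2Space X]
    {L H B : Type*} [Ring L] [Algebra ℂ L] [Ring H] [Algebra ℂ H] [Ring B] [Algebra ℂ B]
    (𝓗 : HopfAlgebroid ℂ L C(X, ℂ) H) (ι : C(X, ℂ) →ₐ[ℂ] B) (ρ : ComoduleAlgebra 𝓗 ι)
    (hcov : IsLocalCovering ρ) (hcentral : IsCentralIn 𝓗 ι) (x : X) :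
    ∃ χ : L →ₐ[ℂ] ℂ, (∀ l, χ l = 𝓗.right.counit (𝓗.left.source l) x) ∧
      -- the fibres of `H` as a left `L`-module and as a right `C(X)`-module are the same
      TwoSidedIdeal.span (𝓗.left.source '' {l | χ l = 0}) = fibreIdeal 𝓗.right.source x ∧
      ∃ (𝓗x : HopfAlgebroid ℂ ℂ ℂ (Fibre 𝓗.right.source x))
        (ρx : ComoduleAlgebra 𝓗x (Algebra.ofId ℂ (Fibre ι x))),
        𝓗.IsGeometricHom 𝓗x χ (ContinuousMap.evalAlgHom ℂ ℂ x) (toFibre 𝓗.right.source x) ∧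
        ρ.IsCompatible ρx χ (ContinuousMap.evalAlgHom ℂ ℂ x) (toFibre 𝓗.right.source x)
          (toFibre ι x) ∧
        IsLocalCovering ρx := by
  have hπ := isFibreMap_toFibre hcentral.source_comm x
  have hp := isFibreMap_toFibre hcentral.inclusion_comm x
  have h𝓗 := hcov.descends hcentral hπ
  have hρ := hcov.comodule_descends hcentral hπ hp
  refine ⟨(ContinuousMap.evalAlgHom ℂ ℂ x).comp 𝓗.baseHom, fun l => rfl, ?_, h𝓗.fibre, hρ.fibre h𝓗,
    h𝓗.isGeometricHom, hρ.isCompatible h𝓗, hcov.fibre hcentral hπ hp hρ h𝓗⟩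
  -- Already the generating sets coincide: `s_L(l) = s_R(θ l)`, and conversely `s_R(a) =
  -- s_L(ε_L(s_R(a)))`.
  refine congrArg TwoSidedIdeal.span (Set.ext fun h => ⟨?_, ?_⟩)
  · rintro ⟨l, hl, rfl⟩
    exact ⟨𝓗.baseHom l, hl, (hcov.left_source l).symm⟩
  · rintro ⟨a, ha, rfl⟩
    refine ⟨𝓗.left.counit (𝓗.right.source a), ?_, hcov.left_source_counit a⟩
    change 𝓗.baseHom _ x = 0
    rw [hcov.baseHom_counit_source]
    exact ha
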